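/- For $N\ge 1$ and a real function $W$ on $\mathbb{C}$ let $$Z_N^{\mathbb H}(W)=\frac1{N!}\int_{\mathbb{C}^N}\prod_{j=1}^N e^{-2W(z_j)}|z_j-\bar z_j|^2\prod_{1\le j<k\le N}|z_k-z_j|^2\,|z_k-\bar z_j|^2\;\prod_{j=1}^N d^2z_j$$ be the partition function of the planar symplectic ensemble with potential $W$, where $d^2z$ is Lebesgue measure on $\mathbb{C}$. Let $W^{\rm g}(z)=|z|^2$ be the potential of the Ginibre symplectic ensemble (GinSE) and, for $\tau\in[0,1)$, let $W^{\rm e}(z)=\frac{1}{1-\tau^2}\bigl(|z|^2-\tau\,\mathrm{Re}\,z^2\bigr)$ be that of the elliptic GinSE. Write $\zeta$ for the Riemann zeta function. **Proposition.** The integrals defining $Z_N^{\mathbb H}(W^{\rm e})$ and $Z_N^{\mathbb H}(NW^{\rm g})$ converge and are positive, and as $N\to\infty$ $$\log Z_N^{\mathbb H}(W^{\rm e})=N^2\log N-\frac32N^2+\frac12N\log N+\Bigl(\frac{\log(4\pi^3(1-\tau)^3(1+\tau))}{2}-\frac12\Bigr)N-\frac1{24}\log N+\frac{5\log2}{24}+\frac12\zeta'(-1)-\frac1{48N}-\frac1{1920N^2}+O\Bigl(\frac1{N^3}\Bigr),$$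 where the implied constant is absolute (independent of $\tau\in[0,1)$). In particular, $$\log Z_N^{\mathbb H}(NW^{\rm g})=-\frac32N^2-\frac12N\log N+\Bigl(\frac{\log(4\pi^3)}{2}-\frac12\Bigr)N-\frac1{24}\log N+\frac{5\log2}{24}+\frac12\zeta'(-1)-\frac1{48N}-\frac1{1920N^2}+O\Bigl(\frac1{N^3}\Bigr).$$ -/

import Mathlib

open MeasureTheory
open scoped ComplexConjugate

/-- The unnormalised eigenvalue density of the planar symplectic ensemble with potential `W`,
`∏_j e^{-2 W(z_j)} |z_j - conj z_j|² ∏_{j<k} |z_k - z_j|² |z_k - conj z_j|²`. The real potential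
`W(z, conj z)` is written as a real function of the complex variable `z`. -/
noncomputable def symplecticWeight (W : ℂ → ℝ) (N : ℕ) (z : Fin N → ℂ) : ℝ :=
  (∏ j, Real.exp (-2 * W (z j)) * ‖z j - conj (z j)‖ ^ 2) *
    ∏ j, ∏ k ∈ Finset.Ioi j, ‖z k - z j‖ ^ 2 * ‖z k - conj (z j)‖ ^ 2

/-- The partition function `Z_N^ℍ(W) = (1 / N!) ∫_{ℂ^N} symplecticWeight W N`, with respect to
Lebesgue measure on `ℂ^N`. -/
noncomputable def symplecticPartition (W : ℂ → ℝ) (N : ℕ) : ℝ :=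
  (1 / (N.factorial : ℝ)) * ∫ z : Fin N → ℂ, symplecticWeight W N z

/-- The potential of the GinSE, `W^g(z) = |z|²`. -/
noncomputable def ginSEPotential (z : ℂ) : ℝ := ‖z‖ ^ 2

/-- The potential of the elliptic GinSE, `W^e(z) = (|z|² - τ Re z²) / (1 - τ²)`. -/
noncomputable def ellipticPotential (τ : ℝ) (z : ℂ) : ℝ :=
  1 / (1 - τ ^ 2) * (‖z‖ ^ 2 - τ * (z ^ 2).re)

open Filter Topology
open scoped Polynomial

/-! ### Euler–Maclaurin summation and the derivative of the zeta function at `-1` -/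

/-! Both potentials are quadratic, `a x² + b y²`, and for these the partition function has an exact
product formula. Up to one factor `z_j - conj z_j` per variable and the Gaussian, the weight is the
Vandermonde determinant of the `2N` points `z_j, conj z_j` (`ofReal_symplecticWeight`). Monomials
may be replaced by any monic polynomials. After the Leibniz expansion, Fubini turns each term into a
product of skew pairings.

Gaussian integration by parts makes suitably scaled Hermite polynomials `q_n` orthogonal, with `q_n'
= n q_{n-1}`. It also expresses the skew pairing through derivatives, so `⟨q_m, q_n⟩` vanishes
unless `|m - n| = 1`. No skew-orthogonal basis is needed: the only perfect matching of `0, …, 2N -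
1` by neighbours is `{0,1}, {2,3}, …`, so all surviving permutations contribute the same product
(`sum_perm_tridiagonal`). Hence `Z_N = ∏ 2 g_{2k}` with explicit positive skew norms `g`.

Taking logarithms leaves elementary terms and `∑ log (2k+1)!`, which is a combination of `log
(2N)!`, `log N!` and `∑_{k ≤ 2N} k log k` (`sum_log_factorial_odd`). The factorials are expanded by
Stirling with an explicit error. The last sum has Glaisher–Kinkelin constant `1/12 - ζ'(-1)`, found
by continuing `ζ` past `-1` with an Euler–Maclaurin series and differentiating termwise. -/

theorem norm_le_of_hasDerivAt_of_norm_le {g g' : ℝ → ℂ} {M : ℝ} (h0 : g 0 = 0)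
    (hg : ∀ t ∈ Set.Icc (0 : ℝ) 1, HasDerivAt g (g' t) t)
    (hM : ∀ t ∈ Set.Icc (0 : ℝ) 1, ‖g' t‖ ≤ M) : ∀ t ∈ Set.Icc (0 : ℝ) 1, ‖g t‖ ≤ M := by
  intro t ht
  have h := (convex_Icc (0 : ℝ) 1).norm_image_sub_le_of_norm_hasDerivWithin_le
    (fun x hx => (hg x hx).hasDerivWithinAt) hM (Set.left_mem_Icc.2 zero_le_one) ht
  rw [h0, sub_zero, sub_zero] at h
  have hM0 : 0 ≤ M := (norm_nonneg _).trans (hM t ht)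
  have : ‖t‖ ≤ 1 := by rw [Real.norm_eq_abs, abs_of_nonneg ht.1]; exact ht.2
  exact h.trans (by nlinarith)

/-- The error of the trapezoidal rule on `[a, a + 1]` with endpoint correction is controlled by the
fourth derivative. -/
theorem norm_corrected_trapezoid_le {F f f1 f2 f3 f4 : ℝ → ℂ} {a M : ℝ}
    (hF : ∀ x ∈ Set.Icc a (a + 1), HasDerivAt F (f x) x)
    (hf : ∀ x ∈ Set.Icc a (a + 1), HasDerivAt f (f1 x) x)
    (hf1 : ∀ x ∈ Set.Icc a (a + 1), HasDerivAt f1 (f2 x) x)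
    (hf2 : ∀ x ∈ Set.Icc a (a + 1), HasDerivAt f2 (f3 x) x)
    (hf3 : ∀ x ∈ Set.Icc a (a + 1), HasDerivAt f3 (f4 x) x)
    (hM : ∀ x ∈ Set.Icc a (a + 1), ‖f4 x‖ ≤ M) :
    ‖(f a + f (a + 1)) / 2 - (F (a + 1) - F a) - (f1 (a + 1) - f1 a) / 12‖ ≤ M := by
  have shift : ∀ {g g' : ℝ → ℂ}, (∀ x ∈ Set.Icc a (a + 1), HasDerivAt g (g' x) x) →
      ∀ t ∈ Set.Icc (0 : ℝ) 1, HasDerivAt (fun t => g (a + t)) (g' (a + t)) t := by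
    intro g g' h t ht
    exact (h (a + t) ⟨by linarith [ht.1], by linarith [ht.2]⟩).comp_const_add a t
  have hid : ∀ t : ℝ, HasDerivAt (fun t : ℝ => (t : ℂ)) 1 t := fun t => Complex.ofRealCLM.hasDerivAt
  -- The corrected error on `[a, a + t]`, as a function of `t`, vanishes at `0` with its first two
  -- derivatives, and its third derivative is `-t² f4(a + t) / 12`. Three applications of the mean
  -- value inequality descend from that bound: `e3`, `e2`, `e1` concern the second derivative, the
  -- first, and the error itself.
  have e3 : ∀ t ∈ Set.Icc (0 : ℝ) 1,
      ‖-(f1 (a + t) - f1 a) / 6 + t * f2 (a + t) / 6 - t ^ 2 * f3 (a + t) / 12‖ ≤ M := by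
    refine norm_le_of_hasDerivAt_of_norm_le (g' := fun t => -(t ^ 2 * f4 (a + t) / 12)) (by simp)
      (fun t ht => ?_) (fun t ht => ?_)
    · have := ((((shift hf1 t ht).sub_const (f1 a)).neg.div_const 6).add
        (((hid t).mul (shift hf2 t ht)).div_const 6)).sub
        ((((hid t).pow 2).mul (shift hf3 t ht)).div_const 12)
      refine this.congr_deriv ?_
      simp only [Pi.pow_apply]
      push_cast
      ring
    · have hb := hM (a + t) ⟨by linarith [ht.1], by linarith [ht.2]⟩
      have ht2 : t ^ 2 ≤ 1 := pow_le_one₀ ht.1 ht.2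
      have h0 := norm_nonneg (f4 (a + t))
      rw [norm_neg, norm_div, norm_mul, norm_pow, Complex.norm_real, Real.norm_eq_abs, sq_abs]
      norm_num
      nlinarith [sq_nonneg t]
  have e2 : ∀ t ∈ Set.Icc (0 : ℝ) 1,
      ‖f a / 2 - f (a + t) / 2 + t * f1 (a + t) / 3 + t * f1 a / 6 - t ^ 2 * f2 (a + t) / 12‖
        ≤ M := by
    refine norm_le_of_hasDerivAt_of_norm_le (by simp) (fun t ht => ?_) e3
    have := (((((shift hf t ht).div_const 2).const_sub (f a / 2)).add
        (((hid t).mul (shift hf1 t ht)).div_const 3)).add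
        (((hid t).mul_const (f1 a)).div_const 6)).sub
        ((((hid t).pow 2).mul (shift hf2 t ht)).div_const 12)
    refine this.congr_deriv ?_
    simp only [Pi.pow_apply]
    push_cast
    ring
  have e1 := norm_le_of_hasDerivAt_of_norm_le (M := M)
    (g := fun t : ℝ => t * (f a + f (a + t)) / 2 - (F (a + t) - F a)
      - (t : ℂ) ^ 2 * (f1 (a + t) - f1 a) / 12) (by simp) (fun t ht => ?_) e2 1 (by simp)
  · simpa using e1
  · have := ((((hid t).mul ((shift hf t ht).const_add (f a))).div_const 2).sub
      ((shift hF t ht).sub_const (F a))).sub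
      ((((hid t).pow 2).mul ((shift hf1 t ht).sub_const (f1 a))).div_const 12)
    refine this.congr_deriv ?_
    simp only [Pi.pow_apply]
    push_cast
    ring

/-- The corrected trapezoidal error of `x ↦ x ^ (-s)` on `[x, x + 1]`. -/
noncomputable def zetaTerm (x : ℝ) (s : ℂ) : ℂ :=
  ((x : ℂ) ^ (-s) + ((x + 1 : ℝ) : ℂ) ^ (-s)) / 2
    - (((x + 1 : ℝ) : ℂ) ^ (1 - s) - (x : ℂ) ^ (1 - s)) / (1 - s)
    + s / 12 * (((x + 1 : ℝ) : ℂ) ^ (-s - 1) - (x : ℂ) ^ (-s - 1))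

theorem hasDerivAt_ofReal_cpow {x : ℝ} (hx : 0 < x) (c : ℂ) :
    HasDerivAt (fun y : ℝ => (y : ℂ) ^ c) (c * (x : ℂ) ^ (c - 1)) x :=
  (Complex.hasStrictDerivAt_cpow_const (Complex.ofReal_mem_slitPlane.2 hx)).hasDerivAt.comp_ofReal

/-- The fourth derivative of `y ^ (-s)` is `s(s+1)(s+2)(s+3) y ^ (-s-4)`, and `Re s > -2` makes it
decay at least like `y⁻²`; `840 = 4·5·6·7` bounds the coefficient. This summable bound is what
reaches past `s = -1`. -/
theorem norm_zetaTerm_le {x : ℝ} (hx : 1 ≤ x) {s : ℂ} (hs : s ≠ 1) (hre : -2 < s.re)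
    (hn : ‖s‖ < 4) : ‖zetaTerm x s‖ ≤ 840 / x ^ 2 := by
  have hs1 : 1 - s ≠ 0 := sub_ne_zero.2 hs.symm
  have key := norm_corrected_trapezoid_le (a := x) (M := 840 / x ^ 2)
    (F := fun y => (y : ℂ) ^ (1 - s) / (1 - s)) (f := fun y => (y : ℂ) ^ (-s))
    (f1 := fun y => -s * (y : ℂ) ^ (-s - 1))
    (f2 := fun y => -s * ((-s - 1) * (y : ℂ) ^ (-s - 1 - 1)))
    (f3 := fun y => -s * ((-s - 1) * ((-s - 1 - 1) * (y : ℂ) ^ (-s - 1 - 1 - 1))))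
    (f4 := fun y => -s * ((-s - 1) * ((-s - 1 - 1) *
      ((-s - 1 - 1 - 1) * (y : ℂ) ^ (-s - 1 - 1 - 1 - 1)))))
    (fun y hy => ?_) (fun y hy => ?_) (fun y hy => ?_) (fun y hy => ?_) (fun y hy => ?_)
    (fun y hy => ?_)
  · convert! key using 2
    simp only [zetaTerm]
    ring
  · refine ((hasDerivAt_ofReal_cpow (by linarith [hy.1]) (1 - s)).div_const (1 - s)).congr_deriv ?_
    rw [mul_div_cancel_left₀ _ hs1]
    congr 1
    ring
  · exact hasDerivAt_ofReal_cpow (by linarith [hy.1]) _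
  · exact (hasDerivAt_ofReal_cpow (by linarith [hy.1]) _).const_mul _
  · exact ((hasDerivAt_ofReal_cpow (by linarith [hy.1]) _).const_mul _).const_mul _
  · exact (((hasDerivAt_ofReal_cpow (by linarith [hy.1]) _).const_mul _).const_mul _).const_mul _
  · have hy0 : 0 < y := by linarith [hy.1]
    have n1 : ‖-s‖ ≤ 4 := by rw [norm_neg]; exact hn.le
    have n2 : ‖-s - 1‖ ≤ 5 := (norm_sub_le _ _).trans (by rw [norm_one]; linarith)
    have n3 : ‖-s - 1 - 1‖ ≤ 6 := (norm_sub_le _ _).trans (by rw [norm_one]; linarith)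
    have n4 : ‖-s - 1 - 1 - 1‖ ≤ 7 := (norm_sub_le _ _).trans (by rw [norm_one]; linarith)
    have n5 : ‖(y : ℂ) ^ (-s - 1 - 1 - 1 - 1)‖ ≤ 1 / x ^ 2 := by
      rw [Complex.norm_cpow_eq_rpow_re_of_pos hy0]
      calc y ^ (-s - 1 - 1 - 1 - 1).re ≤ y ^ (-2 : ℝ) := by
            apply Real.rpow_le_rpow_of_exponent_le (hx.trans hy.1)
            simp
            linarith
        _ ≤ x ^ (-2 : ℝ) := Real.rpow_le_rpow_of_nonpos (by linarith) hy.1 (by norm_num)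
        _ = 1 / x ^ 2 := by
            rw [Real.rpow_neg (by linarith)]
            norm_num
    simp only [norm_mul]
    calc _ ≤ 4 * (5 * (6 * (7 * (1 / x ^ 2)))) := by gcongr
      _ = 840 / x ^ 2 := by ring

theorem sum_range_zetaTerm (n : ℕ) (s : ℂ) :
    ∑ k ∈ Finset.range n, zetaTerm (k + 1) s
      = ∑ k ∈ Finset.range n, 1 / ((k : ℂ) + 1) ^ s - (1 - ((n : ℂ) + 1) ^ (-s)) / 2
        - (((n : ℂ) + 1) ^ (1 - s) - 1) / (1 - s) + s / 12 * (((n : ℂ) + 1) ^ (-s - 1) - 1) := by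
  induction n with
  | zero => simp
  | succ n ih =>
    rw [Finset.sum_range_succ, ih, Finset.sum_range_succ, zetaTerm, one_div, ← Complex.cpow_neg]
    push_cast
    ring

theorem tendsto_natCast_add_one_cpow_zero {c : ℂ} (hc : c.re < 0) :
    Tendsto (fun n : ℕ => ((n : ℂ) + 1) ^ c) atTop (𝓝 0) := by
  rw [tendsto_zero_iff_norm_tendsto_zero]
  have h := (tendsto_rpow_neg_atTop (y := -c.re) (by linarith)).comp
    (tendsto_natCast_atTop_atTop.comp (tendsto_add_atTop_nat 1))
  refine h.congr fun n => ?_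
  have := Complex.norm_cpow_eq_rpow_re_of_pos (x := (n : ℝ) + 1) (by positivity) c
  push_cast at this
  simp [this]

theorem summable_const_div_add_one_sq (C : ℝ) : Summable fun k : ℕ => C / ((k : ℝ) + 1) ^ 2 := by
  have := ((summable_nat_add_iff 1).2 (Real.summable_one_div_nat_pow.2 one_lt_two)).mul_left C
  refine this.congr fun k => ?_
  push_cast
  ring

/-- A convex open set containing `-1` and `2 + 2 * I`, but not `1`. -/
def zetaRegion : Set ℂ := {s | -2 < s.re} ∩ Metric.ball 0 4 ∩ {s | s.re - s.im < 1}

theorem isOpen_zetaRegion : IsOpen zetaRegion :=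
  ((isOpen_lt continuous_const Complex.continuous_re).inter Metric.isOpen_ball).inter
    (isOpen_lt (Complex.continuous_re.sub Complex.continuous_im) continuous_const)

theorem convex_zetaRegion : Convex ℝ zetaRegion := by
  refine ((convex_halfSpace_re_gt _).inter (convex_ball _ _)).inter ?_
  exact convex_halfSpace_lt (f := fun s : ℂ => s.re - s.im)
    (Complex.reLm - Complex.imLm).isLinear 1

theorem ne_one_of_mem_zetaRegion {s : ℂ} (hs : s ∈ zetaRegion) : s ≠ 1 := by
  rintro rfl
  have := hs.2
  simp at this

theorem norm_zetaTerm_le_of_mem {s : ℂ} (hs : s ∈ zetaRegion) (k : ℕ) :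
    ‖zetaTerm (k + 1) s‖ ≤ 840 / ((k : ℝ) + 1) ^ 2 :=
  norm_zetaTerm_le (by simp) (ne_one_of_mem_zetaRegion hs) hs.1.1 (by simpa using hs.1.2)

theorem differentiableOn_zetaTerm {x : ℝ} (hx : 0 < x) :
    DifferentiableOn ℂ (zetaTerm x) zetaRegion := by
  intro s hs
  have h1 : 1 - s ≠ 0 := sub_ne_zero.2 (ne_one_of_mem_zetaRegion hs).symm
  have h2 : (x : ℂ) ≠ 0 := by exact_mod_cast hx.ne'
  have h3 : ((x + 1 : ℝ) : ℂ) ≠ 0 := by exact_mod_cast (by linarith : x + 1 ≠ 0)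
  apply DifferentiableAt.differentiableWithinAt
  unfold zetaTerm
  have c1 : DifferentiableAt ℂ (fun s : ℂ => -s) s := by fun_prop
  have c2 : DifferentiableAt ℂ (fun s : ℂ => 1 - s) s := by fun_prop
  have c3 : DifferentiableAt ℂ (fun s : ℂ => -s - 1) s := by fun_prop
  exact (((c1.const_cpow (.inl h2)).add (c1.const_cpow (.inl h3))).div_const 2).sub
    (((c2.const_cpow (.inl h3)).sub (c2.const_cpow (.inl h2))).div c2 h1) |>.add
    ((differentiableAt_id.div_const 12).mul ((c3.const_cpow (.inl h3)).sub
      (c3.const_cpow (.inl h2))))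

theorem tsum_zetaTerm_of_one_lt_re {s : ℂ} (hs : s ∈ zetaRegion) (h1 : 1 < s.re) :
    ∑' k : ℕ, zetaTerm (k + 1) s = riemannZeta s - 1 / 2 + 1 / (1 - s) - s / 12 := by
  have hsum : Summable fun k : ℕ => zetaTerm (k + 1) s :=
    Summable.of_norm_bounded (summable_const_div_add_one_sq 840) (norm_zetaTerm_le_of_mem hs)
  refine tendsto_nhds_unique hsum.hasSum.tendsto_sum_nat ?_
  simp only [sum_range_zetaTerm]
  have hz : Tendsto (fun n : ℕ => ∑ k ∈ Finset.range n, 1 / ((k : ℂ) + 1) ^ s) atTop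
      (𝓝 (riemannZeta s)) := by
    rw [zeta_eq_tsum_one_div_nat_add_one_cpow h1]
    refine Summable.tendsto_sum_tsum_nat ?_
    have := (summable_nat_add_iff 1).2 (Complex.summable_one_div_nat_cpow.2 h1)
    exact_mod_cast this
  have l1 := tendsto_natCast_add_one_cpow_zero (c := -s) (by simp; linarith)
  have l2 := tendsto_natCast_add_one_cpow_zero (c := 1 - s) (by simp; linarith)
  have l3 := tendsto_natCast_add_one_cpow_zero (c := -s - 1) (by simp; linarith)
  have := ((hz.sub ((l1.const_sub 1).div_const 2)).sub ((l2.sub_const 1).div_const (1 - s))).add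
    ((l3.sub_const 1).const_mul (s / 12))
  convert! this using 2
  ring

/-- Both sides are holomorphic on the region and agree near `2 + 2i`, where the Dirichlet series
converges, so the identity theorem applies. The slanted cut of the region avoids the pole at `1`
while keeping convexity, hence connectedness. -/
theorem riemannZeta_eq_tsum_zetaTerm {s : ℂ} (hs : s ∈ zetaRegion) :
    riemannZeta s = ∑' k : ℕ, zetaTerm (k + 1) s + 1 / 2 - 1 / (1 - s) + s / 12 := by
  have hd : DifferentiableOn ℂ (fun s => ∑' k : ℕ, zetaTerm (k + 1) s) zetaRegion :=
    Complex.differentiableOn_tsum_of_summable_norm (summable_const_div_add_one_sq 840)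
      (fun k => differentiableOn_zetaTerm (by positivity)) isOpen_zetaRegion
      (fun k w hw => norm_zetaTerm_le_of_mem hw k)
  have hl : DifferentiableOn ℂ riemannZeta zetaRegion := fun s hs =>
    (differentiableAt_riemannZeta (ne_one_of_mem_zetaRegion hs)).differentiableWithinAt
  have hr : DifferentiableOn ℂ
      (fun s => ∑' k : ℕ, zetaTerm (k + 1) s + 1 / 2 - 1 / (1 - s) + s / 12) zetaRegion := by
    refine ((hd.add_const _).sub ?_).add (differentiableOn_id.div_const _)
    exact (differentiableOn_const 1).div ((differentiableOn_const 1).sub differentiableOn_id)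
      fun s hs => sub_ne_zero.2 (ne_one_of_mem_zetaRegion hs).symm
  have hp : (2 + 2 * Complex.I) ∈ zetaRegion := by
    refine ⟨⟨by simp, ?_⟩, by simp⟩
    rw [mem_ball_zero_iff]
    rw [Complex.norm_def, Real.sqrt_lt' (by norm_num)]
    simp [Complex.normSq_apply]
    norm_num
  refine (hl.analyticOnNhd isOpen_zetaRegion).eqOn_of_preconnected_of_eventuallyEq
    (hr.analyticOnNhd isOpen_zetaRegion) convex_zetaRegion.isPreconnected hp ?_ hs
  filter_upwards [isOpen_zetaRegion.mem_nhds hp,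
    (isOpen_lt continuous_const Complex.continuous_re).mem_nhds
      (by simp : (1 : ℝ) < (2 + 2 * Complex.I).re)] with s hs h1
  rw [tsum_zetaTerm_of_one_lt_re hs h1]
  ring

/-- The function whose values approximate `∑ k ≤ n, k * log k`. -/
noncomputable def logHyperApprox (x : ℝ) : ℝ :=
  (x ^ 2 / 2 + x / 2 + 1 / 12) * Real.log x - x ^ 2 / 4

/-- Differentiating powers in `s` at `-1` produces `x log x`, `x² log x` and `log x`; these assemble
into an increment of `logHyperApprox`, so the differentiated series telescopes. -/
theorem deriv_zetaTerm_neg_one {x : ℝ} (hx : 0 < x) :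
    deriv (zetaTerm x) (-1)
      = ((logHyperApprox (x + 1) - logHyperApprox x - (x + 1) * Real.log (x + 1) : ℝ) : ℂ) := by
  have h2 : (x : ℂ) ≠ 0 := by exact_mod_cast hx.ne'
  have h3 : ((x + 1 : ℝ) : ℂ) ≠ 0 := by exact_mod_cast (by linarith : x + 1 ≠ 0)
  have i0 := hasDerivAt_id (-1 : ℂ)
  have c1 : HasDerivAt (fun s : ℂ => -s) (-1) (-1) := i0.neg
  have c2 : HasDerivAt (fun s : ℂ => 1 - s) (-1) (-1) := i0.const_sub 1
  have c3 : HasDerivAt (fun s : ℂ => -s - 1) (-1) (-1) := c1.sub_const 1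
  have := ((((c1.const_cpow (.inl h2)).add (c1.const_cpow (.inl h3))).div_const 2).sub
    (((c2.const_cpow (.inl h3)).sub (c2.const_cpow (.inl h2))).div c2 (by norm_num))).add
    ((i0.div_const 12).mul ((c3.const_cpow (.inl h3)).sub (c3.const_cpow (.inl h2))))
  have h := this.deriv
  have e : deriv (zetaTerm x) (-1) = _ := h
  rw [e]
  have l1 : Complex.log x = (Real.log x : ℝ) := (Complex.ofReal_log hx.le).symm
  have l2 : Complex.log ((x + 1 : ℝ) : ℂ) = (Real.log (x + 1) : ℝ) :=
    (Complex.ofReal_log (by linarith)).symm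
  have e1 : (1 : ℂ) - -1 = (2 : ℕ) := by norm_num
  simp only [Pi.sub_apply, id, l1, l2, e1, neg_neg, sub_self, Complex.cpow_one,
    Complex.cpow_zero, Complex.cpow_natCast, logHyperApprox]
  push_cast
  ring

theorem sum_range_deriv_zetaTerm (n : ℕ) :
    ∑ k ∈ Finset.range n, (logHyperApprox ((k : ℝ) + 1 + 1) - logHyperApprox ((k : ℝ) + 1)
        - ((k : ℝ) + 1 + 1) * Real.log ((k : ℝ) + 1 + 1))
      = logHyperApprox (n + 1) + 1 / 4 - ∑ k ∈ Finset.range (n + 1 + 1), (k : ℝ) * Real.log k := by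
  induction n with
  | zero => simp [logHyperApprox, Finset.sum_range_succ]
  | succ n ih =>
    rw [Finset.sum_range_succ, ih, Finset.sum_range_succ _ (n + 1 + 1)]
    push_cast
    ring

/-- Glaisher–Kinkelin asymptotics: the constant in the expansion of `∑ k ≤ n, k * log k` is
`1 / 12 - ζ'(-1)`. -/
theorem tendsto_sum_mul_log_sub :
    Tendsto (fun n : ℕ => ∑ k ∈ Finset.range (n + 1), (k : ℝ) * Real.log k - logHyperApprox n)
      atTop (𝓝 (1 / 12 - (deriv riemannZeta (-1)).re)) := by
  have hm : (-1 : ℂ) ∈ zetaRegion := by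
    refine ⟨⟨?_, ?_⟩, ?_⟩ <;> simp
  have hs := Complex.hasSum_deriv_of_summable_norm (summable_const_div_add_one_sq 840)
      (fun k : ℕ => differentiableOn_zetaTerm (x := (k : ℝ) + 1) (by positivity)) isOpen_zetaRegion
      (fun k w hw => norm_zetaTerm_le_of_mem hw k) hm
  -- `-1/4` and `1/12` are the derivatives of `-1/(1 - s)` and `s/12` at `-1`. The `1/4` later
  -- cancels against `logHyperApprox 1 = -1/4`.
  have hz : deriv riemannZeta (-1)
      = deriv (fun w : ℂ => ∑' k : ℕ, zetaTerm (k + 1) w) (-1) - 1 / 4 + 1 / 12 := by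
    have hd : DifferentiableAt ℂ (fun s => ∑' k : ℕ, zetaTerm (k + 1) s) (-1) :=
      (Complex.differentiableOn_tsum_of_summable_norm (summable_const_div_add_one_sq 840)
      (fun k => differentiableOn_zetaTerm (by positivity)) isOpen_zetaRegion
      (fun k w hw => norm_zetaTerm_le_of_mem hw k)).differentiableAt (isOpen_zetaRegion.mem_nhds hm)
    have e : riemannZeta =ᶠ[𝓝 (-1)]
        fun s => ∑' k : ℕ, zetaTerm (k + 1) s + 1 / 2 - (1 - s)⁻¹ + s / 12 := by
      filter_upwards [isOpen_zetaRegion.mem_nhds hm] with s hs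
      rw [riemannZeta_eq_tsum_zetaTerm hs, one_div (1 - s)]
    rw [e.deriv_eq]
    have i0 := hasDerivAt_id (-1 : ℂ)
    have := (((hd.hasDerivAt.add_const (1 / 2)).sub ((i0.const_sub 1).inv (by norm_num))).add
      (i0.div_const 12)).deriv
    refine Eq.trans this ?_
    norm_num
  have ht := (Complex.hasSum_re hs).tendsto_sum_nat
  simp only [deriv_zetaTerm_neg_one (Nat.cast_add_one_pos (α := ℝ) _), Complex.ofReal_re,
    sum_range_deriv_zetaTerm] at ht
  rw [← tendsto_add_atTop_iff_nat 1]
  have h2 := ht.const_sub (1 / 4)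
  convert! h2 using 2
  · push_cast
    ring
  · rw [hz]
    simp

/-! ### Asymptotic expansions of the factorial and hyperfactorial -/

/-- `log (1 + 1/x) = 2 artanh y` with `y = 1/(2x+1)`; the tail of the odd series is dominated by a
geometric series of ratio `y² ≤ 1/9`. This variable suits increments from `x` to `x + 1`, since `y⁻²
= 4x(x+1) + 1`. -/
theorem log_one_add_inv_bounds {x : ℝ} (hx : 1 ≤ x) :
    |Real.log (1 + 1 / x) - 2 * (1 / (2 * x + 1) + (1 / (2 * x + 1)) ^ 3 / 3
      + (1 / (2 * x + 1)) ^ 5 / 5)| ≤ (1 / (2 * x + 1)) ^ 7 := by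
  have h := Real.hasSum_log_one_add_inv (a := x) (by linarith)
  set y := 1 / (2 * x + 1) with hy
  have hy0 : 0 ≤ y := by positivity
  have hy1 : y ≤ 1 / 3 := one_div_le_one_div_of_le (by norm_num) (by linarith)
  have h3 := (hasSum_nat_add_iff' 3).2 h
  simp only [Finset.sum_range_succ, Finset.sum_range_zero] at h3
  have hg : HasSum (fun k : ℕ => 2 / 7 * y ^ 7 * (y ^ 2) ^ k) (2 / 7 * y ^ 7 * (1 - y ^ 2)⁻¹) :=
    (hasSum_geometric_of_lt_one (by positivity) (by nlinarith)).mul_left _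
  have hle := hasSum_le (fun k => ?_) h3 hg
  · have hnn := h3.nonneg (fun k => by positivity)
    norm_num at hle hnn
    rw [one_div x, abs_le]
    have hinv : (1 - y ^ 2)⁻¹ ≤ 9 / 8 := by
      rw [inv_le_comm₀ (by nlinarith) (by norm_num)]
      nlinarith
    have h7 : 0 ≤ y ^ 7 := by positivity
    constructor
    · linarith
    · nlinarith
  · have hk : (0 : ℝ) ≤ k := Nat.cast_nonneg k
    have : 2 * (1 / (2 * ((k + 3 : ℕ) : ℝ) + 1)) ≤ 2 / 7 := by
      rw [mul_one_div]
      apply div_le_div_of_nonneg_left (by norm_num) (by norm_num)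
      push_cast
      linarith
    calc _ ≤ 2 / 7 * y ^ (2 * (k + 3) + 1) := by gcongr
      _ = _ := by ring

/-- A sequence tending to zero is bounded by `n ^ (-p)` if its increments are bounded by those of
`n ^ (-p)`. -/
theorem abs_le_of_tendsto_zero_of_increments {D : ℕ → ℝ} {p : ℕ} (hp : p ≠ 0)
    (hD : Tendsto D atTop (𝓝 0))
    (h : ∀ n : ℕ, 1 ≤ n → |D (n + 1) - D n| ≤ 1 / (n : ℝ) ^ p - 1 / ((n : ℝ) + 1) ^ p) :
    ∀ n : ℕ, 1 ≤ n → |D n| ≤ 1 / (n : ℝ) ^ p := by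
  have ht : Tendsto (fun n : ℕ => 1 / ((n + 1 : ℕ) : ℝ) ^ p) atTop (𝓝 0) := by
    have := (tendsto_pow_atTop (α := ℝ) hp).comp
      (tendsto_natCast_atTop_atTop.comp (tendsto_add_atTop_nat 1))
    simpa [Function.comp_def, Pi.inv_def] using this.inv_tendsto_atTop
  have hD' := (tendsto_add_atTop_iff_nat 1).2 hD
  -- `D n - n⁻ᵖ` increases to `0` and `D n + n⁻ᵖ` decreases to `0`, so the first is `≤ 0` and the
  -- second `≥ 0`.
  have up : Monotone fun n : ℕ => D (n + 1) - 1 / ((n + 1 : ℕ) : ℝ) ^ p := by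
    refine monotone_nat_of_le_succ fun n => ?_
    have := (abs_le.1 (h (n + 1) (by omega))).1
    push_cast at this ⊢
    linarith
  have dn : Antitone fun n : ℕ => D (n + 1) + 1 / ((n + 1 : ℕ) : ℝ) ^ p := by
    refine antitone_nat_of_succ_le fun n => ?_
    have := (abs_le.1 (h (n + 1) (by omega))).2
    push_cast at this ⊢
    linarith
  intro n hn
  obtain ⟨m, rfl⟩ := Nat.exists_eq_add_of_le' hn
  have h1 := up.ge_of_tendsto (by simpa using hD'.sub ht) m
  have h2 := dn.le_of_tendsto (by simpa using hD'.add ht) m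
  rw [abs_le]
  constructor <;> linarith

/-- With `m = x(x+1)` this is the rational part of the increment of the Stirling remainder. The
coefficients `1/12` and `1/360` are exactly those that cancel the orders `m⁻¹` and `m⁻²`. -/
theorem abs_stirling_rational_le {m : ℝ} (hm : 0 < m) :
    |-(1 / (4 * m + 1)) / 3 - (1 / (4 * m + 1)) ^ 2 / 5 + 1 / (12 * m)
      - (3 * m + 1) / (360 * m ^ 3)| ≤ 1 / m ^ 3 := by
  have e : -(1 / (4 * m + 1)) / 3 - (1 / (4 * m + 1)) ^ 2 / 5 + 1 / (12 * m)
      - (3 * m + 1) / (360 * m ^ 3) = -(10 * m ^ 2 + 11 * m + 1) / (360 * m ^ 3 * (4 * m + 1) ^ 2) := by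
    field_simp
    ring
  rw [e, abs_div, abs_neg, abs_of_pos (by positivity), abs_of_pos (by positivity),
    div_le_div_iff₀ (by positivity) (by positivity)]
  have : 10 * m ^ 2 + 11 * m + 1 ≤ 360 * (4 * m + 1) ^ 2 := by nlinarith
  nlinarith [pow_pos hm 3]

/-- The analogue for `∑ k log k`, with the factor `2x + 1` of the increment removed; `1/720` cancels
the order `m⁻²`. -/
theorem abs_hyper_rational_le {m : ℝ} (hm : 0 < m) :
    |-(m + 1 / 6) * (1 / (4 * m + 1) + (1 / (4 * m + 1)) ^ 2 / 3 + (1 / (4 * m + 1)) ^ 3 / 5)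
      + 1 / 4 + 1 / (720 * m ^ 2)| ≤ 1 / m ^ 3 := by
  have e : -(m + 1 / 6) * (1 / (4 * m + 1) + (1 / (4 * m + 1)) ^ 2 / 3
      + (1 / (4 * m + 1)) ^ 3 / 5) + 1 / 4 + 1 / (720 * m ^ 2)
      = (44 * m ^ 2 + 12 * m + 1) / (720 * m ^ 2 * (4 * m + 1) ^ 3) := by
    field_simp
    ring
  rw [e, abs_of_pos (by positivity), div_le_div_iff₀ (by positivity) (by positivity)]
  have h1 : 44 * m ^ 2 + 12 * m + 1 ≤ 720 * (4 * m + 1) ^ 2 := by nlinarith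
  have h2 : m ≤ 4 * m + 1 := by linarith
  calc (44 * m ^ 2 + 12 * m + 1) * m ^ 3 ≤ 720 * (4 * m + 1) ^ 2 * m ^ 3 := by gcongr
    _ = 720 * m ^ 2 * (4 * m + 1) ^ 2 * m := by ring
    _ ≤ 720 * m ^ 2 * (4 * m + 1) ^ 2 * (4 * m + 1) := by gcongr
    _ = _ := by ring

theorem abs_log_factorial_sub_le (n : ℕ) (hn : 1 ≤ n) :
    |Real.log n.factorial - (n * Real.log n - n + Real.log n / 2 + Real.log (2 * Real.pi) / 2
      + 1 / (12 * n) - 1 / (360 * (n : ℝ) ^ 3))| ≤ 1 / (n : ℝ) ^ 4 := by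
  refine abs_le_of_tendsto_zero_of_increments (D := fun n : ℕ => Real.log n.factorial -
    (n * Real.log n - n + Real.log n / 2 + Real.log (2 * Real.pi) / 2
      + 1 / (12 * n) - 1 / (360 * (n : ℝ) ^ 3))) (p := 4) (by norm_num) ?_ ?_ n hn
  · have h1 := (Real.continuousAt_log (by positivity : √Real.pi ≠ 0)).tendsto.comp
      Stirling.tendsto_stirlingSeq_sqrt_pi
    have h2 : Tendsto (fun n : ℕ => 1 / (12 * (n : ℝ)) - 1 / (360 * (n : ℝ) ^ 3)) atTop (𝓝 0) := by
      have a := tendsto_one_div_atTop_nhds_zero_nat (𝕜 := ℝ)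
      have := (a.div_const 12).sub ((a.pow 3).div_const 360)
      norm_num at this
      refine this.congr fun n => ?_
      simp only [div_eq_mul_inv, mul_inv]
      ring
    have h3 := (h1.sub_const (Real.log √Real.pi)).sub h2
    rw [sub_self, sub_zero] at h3
    refine h3.congr' ?_
    filter_upwards [eventually_ge_atTop 1] with n hn
    have hn0 : (n : ℝ) ≠ 0 := by positivity
    simp only [Function.comp]
    rw [Stirling.log_stirlingSeq_formula, Real.log_div hn0 (Real.exp_ne_zero _), Real.log_exp,
      Real.log_sqrt Real.pi_pos.le, Real.log_mul two_ne_zero hn0,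
      Real.log_mul two_ne_zero Real.pi_ne_zero]
    ring
  · intro n hn
    have hx : (1 : ℝ) ≤ n := by exact_mod_cast hn
    set x : ℝ := (n : ℝ)
    have hx0 : 0 < x := by linarith
    have hL := log_one_add_inv_bounds hx
    set L := Real.log (1 + 1 / x) with hLdef
    have hlog : Real.log (x + 1) = Real.log x + L := by
      rw [hLdef, ← Real.log_mul hx0.ne' (by positivity)]
      congr 1
      field_simp
    have hm : 0 < x * (x + 1) := by positivity
    have hR := abs_stirling_rational_le hm
    have e4 : 4 * (x * (x + 1)) + 1 = (2 * x + 1) ^ 2 := by ring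
    rw [e4] at hR
    set y := 1 / (2 * x + 1) with hy
    have hy0 : 0 < y := by positivity
    have hxy : (x + 1 / 2) * (2 * y) = 1 := by rw [hy]; field_simp
    have hy2 : 1 / (2 * x + 1) ^ 2 = y ^ 2 := by rw [hy, one_div_pow]
    rw [hy2] at hR
    have hy6 : y ^ 6 ≤ 1 / (x * (x + 1)) ^ 3 := by
      rw [show y ^ 6 = 1 / (4 * (x * (x + 1)) + 1) ^ 3 by
        rw [e4, hy, one_div_pow, ← pow_mul]]
      apply one_div_le_one_div_of_le (by positivity)
      gcongr
      linarith
    have hE : |(x + 1 / 2) * (L - 2 * (y + y ^ 3 / 3 + y ^ 5 / 5))| ≤ y ^ 6 / 2 := by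
      rw [abs_mul, abs_of_pos (by positivity)]
      calc _ ≤ (x + 1 / 2) * y ^ 7 := by gcongr
        _ = (x + 1 / 2) * (2 * y) * (y ^ 6 / 2) := by ring
        _ = y ^ 6 / 2 := by rw [hxy, one_mul]
    -- The increment is of order `x⁻⁶`, which fits under the telescoping difference of `x⁻⁴`, itself
    -- of order `x⁻⁵`.
    have hB : 2 * (1 / (x * (x + 1)) ^ 3) ≤ 1 / x ^ 4 - 1 / (x + 1) ^ 4 := by
      rw [div_sub_div _ _ (by positivity) (by positivity), mul_one_div,
        div_le_div_iff₀ (by positivity) (by positivity)]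
      have : 2 * (x * (x + 1)) ≤ (x + 1) ^ 4 - x ^ 4 := by nlinarith [pow_pos hx0 3]
      nlinarith [pow_pos hm 3]
    have e : (Real.log ((n + 1).factorial : ℝ) - (((n + 1 : ℕ) : ℝ) * Real.log ((n + 1 : ℕ) : ℝ)
          - ((n + 1 : ℕ) : ℝ) + Real.log ((n + 1 : ℕ) : ℝ) / 2 + Real.log (2 * Real.pi) / 2
          + 1 / (12 * ((n + 1 : ℕ) : ℝ)) - 1 / (360 * ((n + 1 : ℕ) : ℝ) ^ 3)))
        - (Real.log (n.factorial : ℝ) - (x * Real.log x - x + Real.log x / 2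
          + Real.log (2 * Real.pi) / 2 + 1 / (12 * x) - 1 / (360 * x ^ 3)))
        = (-y ^ 2 / 3 - (y ^ 2) ^ 2 / 5 + 1 / (12 * (x * (x + 1)))
            - (3 * (x * (x + 1)) + 1) / (360 * (x * (x + 1)) ^ 3))
          - (x + 1 / 2) * (L - 2 * (y + y ^ 3 / 3 + y ^ 5 / 5)) := by
      have hc : ((n + 1 : ℕ) : ℝ) = x + 1 := by push_cast; rfl
      rw [Nat.factorial_succ, Nat.cast_mul, Real.log_mul (by positivity) (by positivity), hc, hlog]
      have r1 : 1 / (12 * (x * (x + 1))) = 1 / (12 * x) - 1 / (12 * (x + 1)) := by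
        field_simp
        ring
      have r2 : (3 * (x * (x + 1)) + 1) / (360 * (x * (x + 1)) ^ 3)
          = 1 / (360 * x ^ 3) - 1 / (360 * (x + 1) ^ 3) := by
        field_simp
        ring
      rw [r1, r2]
      linear_combination (-(1 + y ^ 2 / 3 + y ^ 4 / 5)) * hxy
    rw [e]
    refine (abs_sub _ _).trans ?_
    linarith [pow_pos hy0 6]

theorem abs_sum_mul_log_sub_le (n : ℕ) (hn : 1 ≤ n) :
    |∑ k ∈ Finset.range (n + 1), (k : ℝ) * Real.log k - logHyperApprox n
      - (1 / 12 - (deriv riemannZeta (-1)).re) - 1 / (720 * (n : ℝ) ^ 2)| ≤ 1 / (n : ℝ) ^ 3 := by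
  refine abs_le_of_tendsto_zero_of_increments (D := fun n : ℕ =>
    ∑ k ∈ Finset.range (n + 1), (k : ℝ) * Real.log k - logHyperApprox n
      - (1 / 12 - (deriv riemannZeta (-1)).re) - 1 / (720 * (n : ℝ) ^ 2)) (p := 3)
      (by norm_num) ?_ ?_ n hn
  · have h2 : Tendsto (fun n : ℕ => 1 / (720 * (n : ℝ) ^ 2)) atTop (𝓝 0) := by
      have a := tendsto_one_div_atTop_nhds_zero_nat (𝕜 := ℝ)
      have := (a.pow 2).div_const 720
      norm_num at this
      refine this.congr fun n => ?_
      simp only [div_eq_mul_inv, mul_inv]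
      ring
    simpa using (tendsto_sum_mul_log_sub.sub_const (1 / 12 - (deriv riemannZeta (-1)).re)).sub h2
  · intro n hn
    have hx : (1 : ℝ) ≤ n := by exact_mod_cast hn
    simp only [Finset.sum_range_succ _ (n + 1)]
    set x : ℝ := (n : ℝ)
    have hx0 : 0 < x := by linarith
    have hL := log_one_add_inv_bounds hx
    set L := Real.log (1 + 1 / x) with hLdef
    have hlog : Real.log (x + 1) = Real.log x + L := by
      rw [hLdef, ← Real.log_mul hx0.ne' (by positivity)]
      congr 1
      field_simp
    have hm : 0 < x * (x + 1) := by positivity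
    have hR := abs_hyper_rational_le hm
    have e4 : 4 * (x * (x + 1)) + 1 = (2 * x + 1) ^ 2 := by ring
    rw [e4] at hR
    set y := 1 / (2 * x + 1) with hy
    have hy0 : 0 < y := by positivity
    have hxy : (2 * x + 1) * y = 1 := by rw [hy]; field_simp
    have hy2 : 1 / (2 * x + 1) ^ 2 = y ^ 2 := by rw [hy, one_div_pow]
    rw [hy2] at hR
    have hy6 : y ^ 6 ≤ 1 / (x * (x + 1)) ^ 3 := by
      rw [show y ^ 6 = 1 / (4 * (x * (x + 1)) + 1) ^ 3 by
        rw [e4, hy, one_div_pow, ← pow_mul]]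
      apply one_div_le_one_div_of_le (by positivity)
      gcongr
      linarith
    have hE : |(x * (x + 1) / 2 + 1 / 12) * (L - 2 * (y + y ^ 3 / 3 + y ^ 5 / 5))|
        ≤ (2 * x + 1) * y ^ 6 := by
      rw [abs_mul, abs_of_pos (by positivity)]
      calc _ ≤ (x * (x + 1) / 2 + 1 / 12) * y ^ 7 := by gcongr
        _ ≤ (2 * x + 1) ^ 2 * y ^ 7 := by gcongr; nlinarith
        _ = (2 * x + 1) * y * ((2 * x + 1) * y ^ 6) := by ring
        _ = _ := by rw [hxy, one_mul]
    have hB : 2 * (2 * x + 1) * (1 / (x * (x + 1)) ^ 3) ≤ 1 / x ^ 3 - 1 / (x + 1) ^ 3 := by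
      rw [div_sub_div _ _ (by positivity) (by positivity), mul_one_div, ← mul_pow]
      gcongr
      nlinarith
    have e : ∑ k ∈ Finset.range (n + 1), (k : ℝ) * Real.log k
          + ((n + 1 : ℕ) : ℝ) * Real.log ((n + 1 : ℕ) : ℝ) - logHyperApprox ((n + 1 : ℕ) : ℝ)
          - (1 / 12 - (deriv riemannZeta (-1)).re) - 1 / (720 * ((n + 1 : ℕ) : ℝ) ^ 2)
        - (∑ k ∈ Finset.range (n + 1), (k : ℝ) * Real.log k - logHyperApprox x
          - (1 / 12 - (deriv riemannZeta (-1)).re) - 1 / (720 * x ^ 2))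
        = (2 * x + 1) * (-(x * (x + 1) + 1 / 6) * (y ^ 2 + (y ^ 2) ^ 2 / 3 + (y ^ 2) ^ 3 / 5)
            + 1 / 4 + 1 / (720 * (x * (x + 1)) ^ 2))
          - (x * (x + 1) / 2 + 1 / 12) * (L - 2 * (y + y ^ 3 / 3 + y ^ 5 / 5)) := by
      have hc : ((n + 1 : ℕ) : ℝ) = x + 1 := by push_cast; rfl
      have r1 : (2 * x + 1) * (1 / (720 * (x * (x + 1)) ^ 2))
          = 1 / (720 * x ^ 2) - 1 / (720 * (x + 1) ^ 2) := by
        field_simp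
        ring
      rw [hc, logHyperApprox, logHyperApprox, hlog]
      linear_combination (x * (x + 1) + 1 / 6) * (y + y ^ 3 / 3 + y ^ 5 / 5) * hxy - r1
    rw [e]
    refine (abs_sub _ _).trans ?_
    rw [abs_mul, abs_of_pos (by positivity : 0 < 2 * x + 1)]
    have : 0 < 2 * x + 1 := by positivity
    have a1 := mul_le_mul_of_nonneg_left hR this.le
    have a2 := mul_le_mul_of_nonneg_left hy6 this.le
    linarith

/-- Multiplicatively: `∏_{k<N} (2k+1)!² = (∏_{j<2N} j!) · (2N-1)!!`. Here `∏_{j<2N} j! = (2N)!^{2N}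
/ ∏_{j≤2N} j^j` and `(2N-1)!! = (2N)! / (2^N N!)`. -/
theorem sum_log_factorial_odd (N : ℕ) :
    2 * ∑ k ∈ Finset.range N, Real.log (2 * k + 1).factorial
      = (2 * N + 1) * Real.log (2 * N).factorial
        - ∑ k ∈ Finset.range (2 * N + 1), (k : ℝ) * Real.log k
        - N * Real.log 2 - Real.log N.factorial := by
  induction N with
  | zero => simp
  | succ N ih =>
    have f1 : Real.log (2 * N + 1).factorial
        = Real.log (2 * N + 1) + Real.log (2 * N).factorial := by
      rw [Nat.factorial_succ, Nat.cast_mul, Real.log_mul (by positivity) (by positivity)]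
      push_cast
      rfl
    have l2 : Real.log (2 * N + 1 + 1) = Real.log 2 + Real.log (N + 1) := by
      rw [← Real.log_mul (by positivity) (by positivity)]
      ring_nf
    have f2 : Real.log (2 * (N + 1)).factorial = Real.log 2 + Real.log (N + 1)
        + (Real.log (2 * N + 1) + Real.log (2 * N).factorial) := by
      rw [← f1, ← l2, show 2 * (N + 1) = 2 * N + 1 + 1 by ring, Nat.factorial_succ, Nat.cast_mul,
        Real.log_mul (by positivity) (by positivity)]
      push_cast
      rfl
    have f3 : Real.log (N + 1).factorial = Real.log (N + 1) + Real.log N.factorial := by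
      rw [Nat.factorial_succ, Nat.cast_mul, Real.log_mul (by positivity) (by positivity)]
      push_cast
      rfl
    rw [Finset.sum_range_succ, mul_add, ih, f2, f3, f1,
      show 2 * (N + 1) + 1 = 2 * N + 1 + 1 + 1 by ring, Finset.sum_range_succ _ (2 * N + 1 + 1),
      Finset.sum_range_succ _ (2 * N + 1)]
    push_cast
    rw [l2]
    ring

/-- The logarithms are free variables, so combining the three expansions is pure algebra. `F₂` is
needed to order `x⁻⁴` because it is multiplied by `2x + 1`. -/
theorem abs_sub_le_of_expansions {x O F₂ F₁ H l₂ lx lp z : ℝ} (hx : 1 ≤ x)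
    (hO : 2 * O = (2 * x + 1) * F₂ - H - x * l₂ - F₁)
    (h₁ : |F₁ - (x * lx - x + lx / 2 + (l₂ + lp) / 2 + 1 / (12 * x) - 1 / (360 * x ^ 3))|
      ≤ 1 / x ^ 4)
    (h₂ : |F₂ - (2 * x * (l₂ + lx) - 2 * x + (l₂ + lx) / 2 + (l₂ + lp) / 2 + 1 / (12 * (2 * x))
      - 1 / (360 * (2 * x) ^ 3))| ≤ 1 / (2 * x) ^ 4)
    (h₃ : |H - (((2 * x) ^ 2 / 2 + 2 * x / 2 + 1 / 12) * (l₂ + lx) - (2 * x) ^ 2 / 4)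
      - (1 / 12 - z) - 1 / (720 * (2 * x) ^ 2)| ≤ 1 / (2 * x) ^ 3) :
    |O - (x ^ 2 * l₂ + x ^ 2 * lx - 3 / 2 * x ^ 2 + 1 / 2 * x * lx + (l₂ + lp / 2 - 1 / 2) * x
      - 1 / 24 * lx + 5 * l₂ / 24 + 1 / 2 * z - 1 / (48 * x) - 1 / (1920 * x ^ 2))|
      ≤ 1 / x ^ 3 := by
  have hx0 : 0 < x := by linarith
  obtain ⟨e₁, he₁⟩ : ∃ e, e = F₁ - (x * lx - x + lx / 2 + (l₂ + lp) / 2 + 1 / (12 * x)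
    - 1 / (360 * x ^ 3)) := ⟨_, rfl⟩
  obtain ⟨e₂, he₂⟩ : ∃ e, e = F₂ - (2 * x * (l₂ + lx) - 2 * x + (l₂ + lx) / 2 + (l₂ + lp) / 2
    + 1 / (12 * (2 * x)) - 1 / (360 * (2 * x) ^ 3)) := ⟨_, rfl⟩
  obtain ⟨e₃, he₃⟩ : ∃ e, e = H - (((2 * x) ^ 2 / 2 + 2 * x / 2 + 1 / 12) * (l₂ + lx)
    - (2 * x) ^ 2 / 4) - (1 / 12 - z) - 1 / (720 * (2 * x) ^ 2) := ⟨_, rfl⟩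
  rw [← he₁] at h₁
  rw [← he₂] at h₂
  rw [← he₃] at h₃
  have key : O - (x ^ 2 * l₂ + x ^ 2 * lx - 3 / 2 * x ^ 2 + 1 / 2 * x * lx
      + (l₂ + lp / 2 - 1 / 2) * x
      - 1 / 24 * lx + 5 * l₂ / 24 + 1 / 2 * z - 1 / (48 * x) - 1 / (1920 * x ^ 2))
      = (2 * x + 1) / 2 * e₂ - e₃ / 2 - e₁ / 2 + 7 / 5760 * (1 / x ^ 3) := by
    have hO' : O = ((2 * x + 1) * F₂ - H - x * l₂ - F₁) / 2 := by linarith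
    rw [hO', he₁, he₂, he₃]
    field_simp
    ring
  -- In units of `x⁻³` the total error is at most `3/32 + 1/16 + 1/2 + 7/5760 < 1`.
  have b₂ : |(2 * x + 1) / 2 * e₂| ≤ 3 / 32 * (1 / x ^ 3) := by
    rw [abs_mul, abs_of_pos (by positivity)]
    calc _ ≤ (2 * x + x) / 2 * (1 / (2 * x) ^ 4) := by gcongr
      _ = 3 / 32 * (1 / x ^ 3) := by field_simp; norm_num
  have b₃ : |e₃| ≤ 1 / 8 * (1 / x ^ 3) := h₃.trans_eq (by field_simp; norm_num)
  have b₁ : |e₁| ≤ 1 / x ^ 3 := h₁.trans (one_div_le_one_div_of_le (by positivity)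
    (pow_le_pow_right₀ hx (by norm_num)))
  have hq : 0 < 1 / x ^ 3 := by positivity
  rw [key]
  generalize 1 / x ^ 3 = q at *
  generalize (2 * x + 1) / 2 * e₂ = w at *
  rw [abs_le] at b₁ b₂ b₃ ⊢
  constructor <;> linarith [b₁.1, b₁.2, b₂.1, b₂.2, b₃.1, b₃.2]

theorem abs_sum_log_factorial_odd_sub_le (N : ℕ) (hN : 1 ≤ N) :
    |∑ k ∈ Finset.range N, Real.log (2 * k + 1).factorial - ((N : ℝ) ^ 2 * Real.log 2
      + (N : ℝ) ^ 2 * Real.log N - 3 / 2 * (N : ℝ) ^ 2 + 1 / 2 * N * Real.log N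
      + (Real.log 2 + Real.log Real.pi / 2 - 1 / 2) * N
      - 1 / 24 * Real.log N + 5 * Real.log 2 / 24 + 1 / 2 * (deriv riemannZeta (-1)).re
      - 1 / (48 * (N : ℝ)) - 1 / (1920 * (N : ℝ) ^ 2))| ≤ 1 / (N : ℝ) ^ 3 := by
  have hx : (1 : ℝ) ≤ N := by exact_mod_cast hN
  have h1 := abs_log_factorial_sub_le N hN
  have h2 := abs_log_factorial_sub_le (2 * N) (by omega)
  have h3 := abs_sum_mul_log_sub_le (2 * N) (by omega)
  rw [logHyperApprox] at h3
  rw [Real.log_mul two_ne_zero Real.pi_ne_zero] at h1 h2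
  have hl : Real.log ((2 * N : ℕ) : ℝ) = Real.log 2 + Real.log N := by
    rw [Nat.cast_mul, Real.log_mul (by norm_num) (by positivity), Nat.cast_two]
  have hc : ((2 * N : ℕ) : ℝ) = 2 * (N : ℝ) := by push_cast; rfl
  rw [hl, hc] at h2 h3
  exact abs_sub_le_of_expansions hx (sum_log_factorial_odd N) h1 h2 h3

/-! ### Planar Gaussian moments and orthogonal polynomials -/

/-- The Gaussian weight `exp (-2 * (a * x ^ 2 + b * y ^ 2))` on the plane. -/
noncomputable def planarGaussian (a b : ℝ) (z : ℂ) : ℝ :=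
  Real.exp (-2 * (a * z.re ^ 2 + b * z.im ^ 2))

/-- The integrand of the planar Gaussian pairing of two polynomials. -/
noncomputable def gaussianPairingIntegrand (a b : ℝ) (f g : ℂ[X]) (z : ℂ) : ℂ :=
  f.eval z * g.eval (conj z) * planarGaussian a b z

/-- The planar Gaussian pairing `∫ f(z) g(conj z) exp (-2 * (a * x ^ 2 + b * y ^ 2))`. -/
noncomputable def gaussianPairing (a b : ℝ) (f g : ℂ[X]) : ℂ :=
  ∫ z, gaussianPairingIntegrand a b f g z

theorem continuous_planarGaussian (a b : ℝ) : Continuous (planarGaussian a b) := by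
  unfold planarGaussian
  fun_prop

theorem integrable_norm_pow_mul_exp {c : ℝ} (hc : 0 < c) (n : ℕ) :
    Integrable fun z : ℂ => ‖z‖ ^ n * Real.exp (-c * ‖z‖ ^ 2) := by
  have h := Complex.integral_rpow_mul_exp_neg_mul_rpow (p := 2) (q := n) (b := c) (by norm_num)
    (by have : (0 : ℝ) ≤ n := n.cast_nonneg
        linarith) hc
  simp only [Real.rpow_natCast, Real.rpow_two] at h
  -- The Bochner integral of a nonintegrable function is `0`, so a positive closed form proves
  -- integrability.
  refine .of_integral_ne_zero (h ▸ ne_of_gt ?_)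
  have : 0 < Real.Gamma (((n : ℝ) + 2) / 2) := Real.Gamma_pos_of_pos (by positivity)
  have := Real.pi_pos
  positivity

theorem integrable_gaussianPairingIntegrand {a b : ℝ} (ha : 0 < a) (hb : 0 < b) (f g : ℂ[X]) :
    Integrable (gaussianPairingIntegrand a b f g) := by
  have hmon : ∀ m n : ℕ, Integrable fun z : ℂ => z ^ m * conj z ^ n * planarGaussian a b z := by
    intro m n
    refine (integrable_norm_pow_mul_exp (c := 2 * min a b) (by positivity) (m + n)).mono' ?_ ?_
    · exact (((continuous_id.pow m).mul (Complex.continuous_conj.pow n)).mul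
        (Complex.continuous_ofReal.comp (continuous_planarGaussian a b))).aestronglyMeasurable
    · refine .of_forall fun z => ?_
      rw [norm_mul, norm_mul, norm_pow, norm_pow, Complex.norm_conj, ← pow_add, Complex.norm_real,
        planarGaussian, Real.norm_eq_abs, Real.abs_exp]
      refine mul_le_mul_of_nonneg_left (Real.exp_le_exp.2 ?_) (by positivity)
      rw [Complex.sq_norm, Complex.normSq_apply]
      have h1 := mul_le_mul_of_nonneg_right (min_le_left a b) (sq_nonneg z.re)
      have h2 := mul_le_mul_of_nonneg_right (min_le_right a b) (sq_nonneg z.im)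
      nlinarith
  have e : gaussianPairingIntegrand a b f g = fun z => ∑ i ∈ Finset.range (f.natDegree + 1),
      ∑ j ∈ Finset.range (g.natDegree + 1),
        f.coeff i * g.coeff j * (z ^ i * conj z ^ j * planarGaussian a b z) := by
    ext z
    rw [gaussianPairingIntegrand, f.eval_eq_sum_range, g.eval_eq_sum_range, Finset.sum_mul_sum,
      Finset.sum_mul]
    refine Finset.sum_congr rfl fun i _ => ?_
    rw [Finset.sum_mul]
    exact Finset.sum_congr rfl fun j _ => by ring
  rw [e]
  exact integrable_finsetSum _ fun i _ => integrable_finsetSum _ fun j _ => (hmon i j).const_mul _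

section

variable {a b : ℝ}

theorem gaussianPairing_add_left (ha : 0 < a) (hb : 0 < b) (f₁ f₂ g : ℂ[X]) :
    gaussianPairing a b (f₁ + f₂) g = gaussianPairing a b f₁ g + gaussianPairing a b f₂ g := by
  rw [gaussianPairing, gaussianPairing, gaussianPairing,
    ← integral_add (integrable_gaussianPairingIntegrand ha hb _ _)
      (integrable_gaussianPairingIntegrand ha hb _ _)]
  congr 1
  ext z
  simp only [gaussianPairingIntegrand, Polynomial.eval_add]
  ring

theorem gaussianPairing_add_right (ha : 0 < a) (hb : 0 < b) (f g₁ g₂ : ℂ[X]) :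
    gaussianPairing a b f (g₁ + g₂) = gaussianPairing a b f g₁ + gaussianPairing a b f g₂ := by
  rw [gaussianPairing, gaussianPairing, gaussianPairing,
    ← integral_add (integrable_gaussianPairingIntegrand ha hb _ _)
      (integrable_gaussianPairingIntegrand ha hb _ _)]
  congr 1
  ext z
  simp only [gaussianPairingIntegrand, Polynomial.eval_add]
  ring

theorem gaussianPairing_C_mul_left (c : ℂ) (f g : ℂ[X]) :
    gaussianPairing a b (Polynomial.C c * f) g = c * gaussianPairing a b f g := by
  rw [gaussianPairing, gaussianPairing, ← integral_const_mul]
  congr 1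
  ext z
  simp only [gaussianPairingIntegrand, Polynomial.eval_mul, Polynomial.eval_C]
  ring

theorem gaussianPairing_C_mul_right (c : ℂ) (f g : ℂ[X]) :
    gaussianPairing a b f (Polynomial.C c * g) = c * gaussianPairing a b f g := by
  rw [gaussianPairing, gaussianPairing, ← integral_const_mul]
  congr 1
  ext z
  simp only [gaussianPairingIntegrand, Polynomial.eval_mul, Polynomial.eval_C]
  ring

theorem hasLineDerivAt_gaussianPairingIntegrand (f g : ℂ[X]) (z v : ℂ) :
    HasLineDerivAt ℝ (gaussianPairingIntegrand a b f g)
      (v * gaussianPairingIntegrand a b f.derivative g z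
        + conj v * gaussianPairingIntegrand a b f g.derivative z
        - 4 * (a * z.re * v.re + b * z.im * v.im) * gaussianPairingIntegrand a b f g z) z v := by
  have hid : HasDerivAt (fun t : ℝ => (t : ℂ)) 1 0 := Complex.ofRealCLM.hasDerivAt
  have h1 : HasDerivAt (fun t : ℝ => f.eval (z + t * v)) (f.derivative.eval z * v) 0 := by
    have := (f.hasDerivAt (z + ((0 : ℝ) : ℂ) * v)).comp (0 : ℝ) ((hid.mul_const v).const_add z)
    simpa [Function.comp_def] using this
  have h2 : HasDerivAt (fun t : ℝ => g.eval (conj z + t * conj v))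
      (g.derivative.eval (conj z) * conj v) 0 := by
    have := (g.hasDerivAt (conj z + ((0 : ℝ) : ℂ) * conj v)).comp (0 : ℝ)
      ((hid.mul_const (conj v)).const_add (conj z))
    simpa [Function.comp_def] using this
  have h3 : HasDerivAt (fun t : ℝ => planarGaussian a b (z + t * v))
      (-4 * (a * z.re * v.re + b * z.im * v.im) * planarGaussian a b z) 0 := by
    have i := hasDerivAt_id (0 : ℝ)
    have := ((((((i.mul_const v.re).const_add z.re).pow 2).const_mul a).add
      ((((i.mul_const v.im).const_add z.im).pow 2).const_mul b)).const_mul (-2)).exp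
    convert! this using 1
    · ext t
      simp [planarGaussian]
    · simp [planarGaussian]
      ring
  have := (h1.mul h2).mul h3.ofReal_comp
  rw [HasLineDerivAt]
  convert! this using 1
  · ext t
    simp [gaussianPairingIntegrand]
  · simp [gaussianPairingIntegrand]
    ring

/-- The derivative of the integrand along `v` integrates to zero. Writing `x` and `y` through `z`
and `conj z` turns the Gaussian's contribution into multiplication by `X` in either slot. The
directions `1` and `I` give the two relations used below. -/
theorem gaussianPairing_integration_by_parts (ha : 0 < a) (hb : 0 < b) (f g : ℂ[X]) (v : ℂ) :
    v * gaussianPairing a b f.derivative g + conj v * gaussianPairing a b f g.derivative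
      = (2 * (a * v.re - Complex.I * b * v.im)) * gaussianPairing a b (Polynomial.X * f) g
        + (2 * (a * v.re + Complex.I * b * v.im)) * gaussianPairing a b f (Polynomial.X * g) := by
  have hi := integrable_gaussianPairingIntegrand ha hb
  have hx : ∀ z : ℂ, (z.re : ℂ) = (z + conj z) / 2 := fun z => by
    rw [Complex.add_conj]; simp
  have hy : ∀ z : ℂ, (z.im : ℂ) = -Complex.I * (z - conj z) / 2 := fun z => by
    rw [Complex.sub_conj]
    push_cast
    linear_combination (z.im : ℂ) * Complex.I_sq
  have e : ∀ z, v * gaussianPairingIntegrand a b f.derivative g z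
        + conj v * gaussianPairingIntegrand a b f g.derivative z
        - 4 * (a * z.re * v.re + b * z.im * v.im) * gaussianPairingIntegrand a b f g z
      = (v * gaussianPairingIntegrand a b f.derivative g z
        + conj v * gaussianPairingIntegrand a b f g.derivative z)
        - ((2 * (a * v.re - Complex.I * b * v.im))
            * gaussianPairingIntegrand a b (Polynomial.X * f) g z
          + (2 * (a * v.re + Complex.I * b * v.im))
            * gaussianPairingIntegrand a b f (Polynomial.X * g) z) := by
    intro z
    rw [hx z, hy z]
    simp only [gaussianPairingIntegrand, Polynomial.eval_mul, Polynomial.eval_X]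
    ring
  have hI1 : Integrable fun z => v * gaussianPairingIntegrand a b f.derivative g z
      + conj v * gaussianPairingIntegrand a b f g.derivative z := ((hi f.derivative g).const_mul v).add ((hi f g.derivative).const_mul (conj v))
  have hI2 : Integrable fun z => (2 * (a * v.re - Complex.I * b * v.im))
        * gaussianPairingIntegrand a b (Polynomial.X * f) g z
      + (2 * (a * v.re + Complex.I * b * v.im))
        * gaussianPairingIntegrand a b f (Polynomial.X * g) z := ((hi (Polynomial.X * f) g).const_mul (2 * (a * v.re - Complex.I * b * v.im))).add
    ((hi f (Polynomial.X * g)).const_mul (2 * (a * v.re + Complex.I * b * v.im)))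
  have h := integral_bilinear_hasLineDerivAt_right_eq_neg_left_of_integrable
    (μ := (volume : Measure ℂ)) (f := fun _ : ℂ => (1 : ℂ)) (f' := fun _ => 0)
    (g := gaussianPairingIntegrand a b f g) (v := v) (B := ContinuousLinearMap.mul ℝ ℂ)
    (by simp) (by
      simp only [ContinuousLinearMap.mul_apply', one_mul]
      exact (hI1.sub hI2).congr (.of_forall fun z => (e z).symm))
    (by simpa using hi f g) (fun x _ => hasDerivAt_const (0 : ℝ) (1 : ℂ))
    (fun x _ => hasLineDerivAt_gaussianPairingIntegrand f g x v)
  simp only [ContinuousLinearMap.mul_apply', one_mul, zero_mul, integral_zero, neg_zero] at h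
  rw [integral_congr_ae (.of_forall e), integral_sub hI1 hI2, sub_eq_zero] at h
  rw [integral_add ((hi _ _).const_mul _) ((hi _ _).const_mul _),
    integral_add ((hi _ _).const_mul _) ((hi _ _).const_mul _)] at h
  simpa only [gaussianPairing, integral_const_mul] using h

theorem gaussianPairing_X_mul_add (ha : 0 < a) (hb : 0 < b) (f g : ℂ[X]) :
    gaussianPairing a b (Polynomial.X * f) g + gaussianPairing a b f (Polynomial.X * g)
      = 1 / (2 * a) * (gaussianPairing a b f.derivative g + gaussianPairing a b f g.derivative) := by
  have h := gaussianPairing_integration_by_parts ha hb f g 1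
  have ha' : (a : ℂ) ≠ 0 := by exact_mod_cast ha.ne'
  simp at h
  rw [h]
  field_simp

theorem gaussianPairing_X_mul_sub (ha : 0 < a) (hb : 0 < b) (f g : ℂ[X]) :
    gaussianPairing a b (Polynomial.X * f) g - gaussianPairing a b f (Polynomial.X * g)
      = 1 / (2 * b) * (gaussianPairing a b f g.derivative - gaussianPairing a b f.derivative g) := by
  have h := gaussianPairing_integration_by_parts ha hb f g Complex.I
  have hb' : (b : ℂ) ≠ 0 := by exact_mod_cast hb.ne'
  simp at h
  have h' : gaussianPairing a b f g.derivative - gaussianPairing a b f.derivative g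
      = 2 * b * (gaussianPairing a b (Polynomial.X * f) g
        - gaussianPairing a b f (Polynomial.X * g)) := by
    apply mul_left_cancel₀ Complex.I_ne_zero
    linear_combination -h
  rw [h']
  field_simp

theorem gaussianPairing_X_mul_left (ha : 0 < a) (hb : 0 < b) (f g : ℂ[X]) :
    gaussianPairing a b (Polynomial.X * f) g
      = (1 / (4 * a) - 1 / (4 * b) : ℝ) * gaussianPairing a b f.derivative g
        + (1 / (4 * a) + 1 / (4 * b) : ℝ) * gaussianPairing a b f g.derivative := by
  have h1 := gaussianPairing_X_mul_add ha hb f g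
  have h2 := gaussianPairing_X_mul_sub ha hb f g
  push_cast
  linear_combination (h1 + h2) / 2

theorem gaussianPairing_X_mul_right (ha : 0 < a) (hb : 0 < b) (f g : ℂ[X]) :
    gaussianPairing a b f (Polynomial.X * g)
      = (1 / (4 * a) + 1 / (4 * b) : ℝ) * gaussianPairing a b f.derivative g
        + (1 / (4 * a) - 1 / (4 * b) : ℝ) * gaussianPairing a b f g.derivative := by
  have h1 := gaussianPairing_X_mul_add ha hb f g
  have h2 := gaussianPairing_X_mul_sub ha hb f g
  push_cast
  linear_combination (h1 - h2) / 2

theorem gaussianPairing_one_one (ha : 0 < a) (hb : 0 < b) :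
    gaussianPairing a b 1 1 = (Real.pi / (2 * √(a * b)) : ℝ) := by
  have e : gaussianPairing a b 1 1 = ∫ z, ((planarGaussian a b z : ℝ) : ℂ) := by
    simp [gaussianPairing, gaussianPairingIntegrand]
  rw [e, integral_complex_ofReal]
  congr 1
  have h1 := Complex.volume_preserving_equiv_real_prod.symm.integral_comp
    Complex.measurableEquivRealProd.symm.measurableEmbedding (planarGaussian a b)
  rw [← h1]
  have h2 : ∀ x : ℝ × ℝ, planarGaussian a b (Complex.measurableEquivRealProd.symm x)
      = Real.exp (-(2 * a) * x.1 ^ 2) * Real.exp (-(2 * b) * x.2 ^ 2) := fun x => by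
    rw [← Real.exp_add, planarGaussian, Complex.measurableEquivRealProd_symm_apply]
    ring_nf
  simp only [h2]
  rw [Measure.volume_eq_prod, integral_prod_mul (fun x : ℝ => Real.exp (-(2 * a) * x ^ 2))
    (fun x : ℝ => Real.exp (-(2 * b) * x ^ 2)), integral_gaussian, integral_gaussian,
    ← Real.sqrt_mul (by positivity), div_mul_div_comm,
    show Real.pi * Real.pi / (2 * a * (2 * b)) = (Real.pi / 2) ^ 2 / (a * b) by ring,
    Real.sqrt_div (by positivity), Real.sqrt_sq (by positivity)]
  field_simp

end

/-- The monic Hermite-type polynomials with `q₀ = 1` and `qₙ₊₁ = X qₙ - p qₙ'`. -/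
noncomputable def monicHermite (p : ℝ) : ℕ → ℂ[X]
  | 0 => 1
  | n + 1 => Polynomial.X * monicHermite p n - Polynomial.C (p : ℂ) * (monicHermite p n).derivative

theorem derivative_monicHermite_succ (p : ℝ) (n : ℕ) :
    (monicHermite p (n + 1)).derivative = Polynomial.C ((n : ℂ) + 1) * monicHermite p n := by
  induction n with
  | zero => simp [monicHermite]
  | succ n ih =>
    rw [monicHermite, Polynomial.derivative_sub, Polynomial.derivative_mul,
      Polynomial.derivative_C_mul, ih, Polynomial.derivative_C_mul, Polynomial.derivative_X]
    rw [monicHermite]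
    push_cast
    simp only [Polynomial.C_add, Polynomial.C_1]
    ring

theorem monicHermite_monic_natDegree (p : ℝ) (n : ℕ) :
    (monicHermite p n).Monic ∧ (monicHermite p n).natDegree = n := by
  induction n with
  | zero => simp [monicHermite]
  | succ n ih =>
    have hX : (Polynomial.X * monicHermite p n).Monic := Polynomial.monic_X.mul ih.1
    have hdX : (Polynomial.X * monicHermite p n).natDegree = n + 1 := by
      rw [Polynomial.natDegree_X_mul ih.1.ne_zero, ih.2]
    have hlt : (Polynomial.C (p : ℂ) * (monicHermite p n).derivative).degree
        < (Polynomial.X * monicHermite p n).degree := by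
      rw [Polynomial.degree_eq_natDegree hX.ne_zero, hdX]
      refine lt_of_le_of_lt Polynomial.degree_le_natDegree ?_
      have h1 := Polynomial.natDegree_C_mul_le (p : ℂ) (monicHermite p n).derivative
      have h2 := Polynomial.natDegree_derivative_le (monicHermite p n)
      rw [ih.2] at h2
      exact_mod_cast (by omega : _ < n + 1)
    refine ⟨hX.sub_of_left hlt, ?_⟩
    rw [monicHermite, Polynomial.natDegree_eq_of_degree_eq
      (Polynomial.degree_sub_eq_left_of_degree_lt hlt), hdX]

/-! ### Orthogonality and tridiagonal skew pairing of the planar Hermite polynomials. -/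

section

variable {a b : ℝ}

/-- The parameter `1/(4a) - 1/(4b)` is chosen to cancel the `f'` term produced by multiplication by
`X`. The raising operator `X - p ∂` is then adjoint to a multiple of differentiation in the other
slot, which gives orthogonality by induction. -/
theorem gaussianPairing_monicHermite_succ_left (ha : 0 < a) (hb : 0 < b) (m : ℕ) (g : ℂ[X]) :
    gaussianPairing a b (monicHermite (1 / (4 * a) - 1 / (4 * b)) (m + 1)) g
      = (1 / (4 * a) + 1 / (4 * b) : ℝ)
        * gaussianPairing a b (monicHermite (1 / (4 * a) - 1 / (4 * b)) m) g.derivative := by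
  rw [monicHermite, sub_eq_add_neg, ← neg_mul, ← Polynomial.C_neg, gaussianPairing_add_left ha hb,
    gaussianPairing_X_mul_left ha hb, gaussianPairing_C_mul_left]
  ring

theorem gaussianPairing_monicHermite_succ_right (ha : 0 < a) (hb : 0 < b) (m : ℕ) (f : ℂ[X]) :
    gaussianPairing a b f (monicHermite (1 / (4 * a) - 1 / (4 * b)) (m + 1))
      = (1 / (4 * a) + 1 / (4 * b) : ℝ)
        * gaussianPairing a b f.derivative (monicHermite (1 / (4 * a) - 1 / (4 * b)) m) := by
  rw [monicHermite, sub_eq_add_neg, ← neg_mul, ← Polynomial.C_neg, gaussianPairing_add_right ha hb,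
    gaussianPairing_X_mul_right ha hb, gaussianPairing_C_mul_right]
  ring

theorem gaussianPairing_monicHermite (ha : 0 < a) (hb : 0 < b) (m n : ℕ) :
    gaussianPairing a b (monicHermite (1 / (4 * a) - 1 / (4 * b)) m)
        (monicHermite (1 / (4 * a) - 1 / (4 * b)) n)
      = if m = n then ((1 / (4 * a) + 1 / (4 * b) : ℝ) ^ m * m.factorial
          * (Real.pi / (2 * √(a * b))) : ℝ) else 0 := by
  have z : ∀ f : ℂ[X], gaussianPairing a b 0 f = 0 ∧ gaussianPairing a b f 0 = 0 := fun f => by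
    simp [gaussianPairing, gaussianPairingIntegrand]
  induction m generalizing n with
  | zero =>
    cases n with
    | zero => simp [monicHermite, gaussianPairing_one_one ha hb]
    | succ n =>
      rw [gaussianPairing_monicHermite_succ_right ha hb, monicHermite, Polynomial.derivative_one,
        (z _).1]
      simp
  | succ m ih =>
    cases n with
    | zero =>
      rw [gaussianPairing_monicHermite_succ_left ha hb, monicHermite, Polynomial.derivative_one,
        (z _).2]
      simp
    | succ n =>
      rw [gaussianPairing_monicHermite_succ_left ha hb, derivative_monicHermite_succ,
        gaussianPairing_C_mul_right, ih]
      by_cases h : m = n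
      · subst h
        simp only [if_true, Nat.factorial_succ, pow_succ]
        push_cast
        ring
      · simp [h]

/-- The skew pairing `∫ f(z) g(conj z) (z - conj z) exp (-2 * (a * x ^ 2 + b * y ^ 2))`. -/
noncomputable def gaussianSkewPairing (a b : ℝ) (f g : ℂ[X]) : ℂ :=
  gaussianPairing a b (Polynomial.X * f) g - gaussianPairing a b f (Polynomial.X * g)

/-- The skew norms `(2 b)⁻¹ * (n + 1)! * q ^ n * c` of consecutive planar Hermite polynomials. -/
noncomputable def gaussianSkewNorm (a b : ℝ) (n : ℕ) : ℝ :=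
  1 / (2 * b) * ((n + 1).factorial * (1 / (4 * a) + 1 / (4 * b)) ^ n
    * (Real.pi / (2 * √(a * b))))

/-- The relation for direction `I` equates the skew pairing with `(⟨f, g'⟩ - ⟨f', g⟩) / (2b)`. Since
differentiation lowers the Hermite index by one, orthogonality leaves only neighbouring indices. -/
theorem gaussianSkewPairing_monicHermite (ha : 0 < a) (hb : 0 < b) (m n : ℕ) :
    gaussianSkewPairing a b (monicHermite (1 / (4 * a) - 1 / (4 * b)) m)
        (monicHermite (1 / (4 * a) - 1 / (4 * b)) n)
      = if n = m + 1 then (gaussianSkewNorm a b m : ℂ)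
        else if m = n + 1 then -(gaussianSkewNorm a b n : ℂ) else 0 := by
  have z : ∀ f : ℂ[X], gaussianPairing a b 0 f = 0 ∧ gaussianPairing a b f 0 = 0 := fun f => by
    simp [gaussianPairing, gaussianPairingIntegrand]
  have h1 : gaussianPairing a b (monicHermite (1 / (4 * a) - 1 / (4 * b)) m)
      (monicHermite (1 / (4 * a) - 1 / (4 * b)) n).derivative
      = if n = m + 1 then (2 * b) * (gaussianSkewNorm a b m : ℂ) else 0 := by
    have hb' : (b : ℂ) ≠ 0 := by exact_mod_cast hb.ne'
    cases n with
    | zero => rw [monicHermite, Polynomial.derivative_one, (z _).2]; simp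
    | succ n =>
      rw [derivative_monicHermite_succ, gaussianPairing_C_mul_right,
        gaussianPairing_monicHermite ha hb]
      by_cases h : m = n
      · subst h
        simp only [if_true, gaussianSkewNorm, Nat.factorial_succ]
        push_cast
        field_simp
      · simp [h, Ne.symm h]
  have h2 : gaussianPairing a b (monicHermite (1 / (4 * a) - 1 / (4 * b)) m).derivative
      (monicHermite (1 / (4 * a) - 1 / (4 * b)) n)
      = if m = n + 1 then (2 * b) * (gaussianSkewNorm a b n : ℂ) else 0 := by
    have hb' : (b : ℂ) ≠ 0 := by exact_mod_cast hb.ne'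
    cases m with
    | zero => rw [monicHermite, Polynomial.derivative_one, (z _).1]; simp
    | succ m =>
      rw [derivative_monicHermite_succ, gaussianPairing_C_mul_left,
        gaussianPairing_monicHermite ha hb]
      by_cases h : m = n
      · subst h
        simp only [if_true, gaussianSkewNorm, Nat.factorial_succ]
        push_cast
        field_simp
      · simp [h]
  have hb' : (b : ℂ) ≠ 0 := by exact_mod_cast hb.ne'
  rw [gaussianSkewPairing, gaussianPairing_X_mul_sub ha hb, h1, h2]
  by_cases c1 : n = m + 1
  · rw [if_pos c1, if_pos c1, if_neg (by omega)]
    field_simp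
    ring
  · rw [if_neg c1, if_neg c1]
    split_ifs
    · field_simp
      ring
    · simp

end

/-! ### The Vandermonde determinant of conjugate pairs -/

theorem finProdFinEquiv_lt_iff {N : ℕ} (a c : Fin N) (i j : Fin 2) :
    finProdFinEquiv (a, i) < finProdFinEquiv (c, j) ↔ a < c ∨ a = c ∧ i < j := by
  rw [Fin.lt_def, Fin.lt_def, Fin.lt_def, Fin.ext_iff]
  simp only [finProdFinEquiv_apply_val]
  omega

/-- The points `z₀, conj z₀, z₁, conj z₁, …`. -/
noncomputable def conjPairs {N : ℕ} (z : Fin N → ℂ) (x : Fin N × Fin 2) : ℂ :=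
  if x.2 = 0 then z x.1 else conj (z x.1)

theorem det_vandermonde_conjPairs {N : ℕ} (z : Fin N → ℂ) :
    (Matrix.vandermonde (conjPairs z ∘ finProdFinEquiv.symm)).det
      = (∏ j, (conj (z j) - z j)) * ∏ j, ∏ k ∈ Finset.Ioi j,
        ((z k - z j) * (conj (z k) - conj (z j)) * ((z k - conj (z j)) * (conj (z k) - z j))) := by
  -- Indicators replace the triangular ranges so that the product can be reindexed by (pair,
  -- member). Diagonal blocks then give `conj z_a - z_a`, blocks with `a < c` the four cross
  -- factors.
  have hite : ∀ (n : ℕ) (F : Fin n → Fin n → ℂ),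
      ∏ i, ∏ j ∈ Finset.Ioi i, F i j = ∏ i, ∏ j, if i < j then F i j else 1 := by
    intro n F
    refine Finset.prod_congr rfl fun i _ => ?_
    rw [← Finset.prod_filter]
    congr 1
    ext j
    simp
  rw [Matrix.det_vandermonde, hite, ← finProdFinEquiv.prod_comp, Fintype.prod_prod_type, hite,
    ← Finset.prod_mul_distrib]
  refine Finset.prod_congr rfl fun a _ => ?_
  rw [Fin.prod_univ_two, ← finProdFinEquiv.prod_comp, ← finProdFinEquiv.prod_comp,
    Fintype.prod_prod_type, Fintype.prod_prod_type]
  simp only [Fin.prod_univ_two, finProdFinEquiv_lt_iff, Function.comp_apply,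
    Equiv.symm_apply_apply, conjPairs]
  have hd : (conj (z a) - z a) = ∏ c, if a = c then conj (z c) - z a else 1 := by simp
  rw [hd, ← Finset.prod_mul_distrib, ← Finset.prod_mul_distrib]
  refine Finset.prod_congr rfl fun c _ => ?_
  rcases lt_trichotomy a c with h | h | h
  · simp [h, h.ne]
    ring
  · subst h
    simp
  · simp [h.not_gt, h.ne']

/-- `|z - conj z|² = (z - conj z)(conj z - z)`: the determinant supplies the second factor, and the
first remains to make the one-variable pairing skew. -/
theorem ofReal_symplecticWeight (W : ℂ → ℝ) (N : ℕ) (z : Fin N → ℂ) :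
    (symplecticWeight W N z : ℂ)
      = (∏ j, ((z j - conj (z j)) * (Real.exp (-2 * W (z j)) : ℂ)))
        * (Matrix.vandermonde (conjPairs z ∘ finProdFinEquiv.symm)).det := by
  have hn : ∀ w : ℂ, ((‖w‖ : ℝ) : ℂ) ^ 2 = w * conj w := fun w => (Complex.mul_conj' w).symm
  rw [det_vandermonde_conjPairs, symplecticWeight]
  push_cast
  simp only [hn, map_sub, Complex.conj_conj, Finset.prod_mul_distrib]
  ring

theorem prod_finProdFinEquiv {N : ℕ} {M : Type*} [CommMonoid M] (F : Fin (N * 2) → M) :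
    ∏ i, F i = ∏ j, (F (finProdFinEquiv (j, 0)) * F (finProdFinEquiv (j, 1))) := by
  rw [← finProdFinEquiv.prod_comp, Fintype.prod_prod_type]
  simp only [Fin.prod_univ_two]

theorem ofReal_symplecticWeight_eq_sum (W : ℂ → ℝ) (N : ℕ) (q : ℕ → ℂ[X])
    (hq : ∀ n, (q n).Monic ∧ (q n).natDegree = n) (z : Fin N → ℂ) :
    (symplecticWeight W N z : ℂ)
      = ∑ σ : Equiv.Perm (Fin (N * 2)), ((Equiv.Perm.sign σ : ℤ) : ℂ) * ∏ j : Fin N,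
        ((z j - conj (z j)) * (Real.exp (-2 * W (z j)) : ℂ)
          * ((q (σ (finProdFinEquiv (j, 0)))).eval (z j)
            * (q (σ (finProdFinEquiv (j, 1)))).eval (conj (z j)))) := by
  rw [ofReal_symplecticWeight, Matrix.det_eval_matrixOfPolynomials_eq_det_vandermonde _
    (fun i : Fin (N * 2) => q i) (fun i => (hq i).2) (fun i => (hq i).1), ← Matrix.det_transpose,
    Matrix.det_apply', Finset.mul_sum]
  refine Finset.sum_congr rfl fun σ _ => ?_
  have h0 : ∀ j, (conjPairs z ∘ finProdFinEquiv.symm) (finProdFinEquiv (j, 0)) = z j := fun j => by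
    rw [Function.comp_apply, Equiv.symm_apply_apply, conjPairs, if_pos rfl]
  have h1 : ∀ j, (conjPairs z ∘ finProdFinEquiv.symm) (finProdFinEquiv (j, 1)) = conj (z j) :=
    fun j => by
      rw [Function.comp_apply, Equiv.symm_apply_apply, conjPairs, if_neg (by simp)]
  rw [mul_left_comm, prod_finProdFinEquiv, ← Finset.prod_mul_distrib]
  simp only [Matrix.transpose_apply, Matrix.of_apply, h0, h1]

/-! ### Signed sums over permutations with a tridiagonal skew kernel -/

/-- A permutation of the pairs followed by swaps inside the pairs. -/
def pairPerm {N : ℕ} (x : Equiv.Perm (Fin N) × (Fin N → Equiv.Perm (Fin 2))) :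
    Equiv.Perm (Fin N × Fin 2) :=
  Equiv.prodCongrLeft (fun _ => x.1) * Equiv.prodCongrRight x.2

theorem pairPerm_apply {N : ℕ} (x : Equiv.Perm (Fin N) × (Fin N → Equiv.Perm (Fin 2)))
    (j : Fin N) (i : Fin 2) : pairPerm x (j, i) = (x.1 j, x.2 j i) := rfl

theorem pairPerm_injective {N : ℕ} : Function.Injective (pairPerm (N := N)) := by
  intro x y h
  have h' : ∀ j i, (x.1 j, x.2 j i) = (y.1 j, y.2 j i) := fun j i => by
    rw [← pairPerm_apply, h, pairPerm_apply]
  refine Prod.ext (Equiv.ext fun j => ?_) (funext fun j => Equiv.ext fun i => ?_)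
  · exact congrArg Prod.fst (h' j 0)
  · exact congrArg Prod.snd (h' j i)

/-- The permutation of the pairs acts identically on both members, so its sign enters squared and
only the inner swaps count. -/
theorem sign_pairPerm {N : ℕ} (x : Equiv.Perm (Fin N) × (Fin N → Equiv.Perm (Fin 2))) :
    Equiv.Perm.sign (pairPerm x) = ∏ j, Equiv.Perm.sign (x.2 j) := by
  rw [pairPerm, Equiv.Perm.sign_mul]
  have h1 := Equiv.Perm.sign_prodCongrLeft (fun _ : Fin 2 => x.1)
  have h2 := Equiv.Perm.sign_prodCongrRight x.2
  rw [h1, h2]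
  simp

theorem mem_range_pairPerm {N : ℕ} (σ : Equiv.Perm (Fin N × Fin 2))
    (h : ∀ j, (σ (j, 0)).1 = (σ (j, 1)).1) : σ ∈ Set.range (pairPerm (N := N)) := by
  have h' : ∀ j i, (σ (j, i)).1 = (σ (j, 0)).1 := fun j i => by
    fin_cases i
    · rfl
    · exact (h j).symm
  -- Two pairs sent to the same pair would put three distinct points into a block of size two.
  have inj1 : Function.Injective fun j => (σ (j, 0)).1 := by
    intro j k e
    by_contra hjk
    have ne : ∀ x y : Fin N × Fin 2, x ≠ y → (σ x).1 = (σ y).1 → (σ x).2 ≠ (σ y).2 :=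
      fun x y hxy h1 h2 => hxy (σ.injective (Prod.ext h1 h2))
    have n1 := ne (j, 0) (j, 1) (by simp) (h j)
    have n2 := ne (j, 0) (k, 0) (by simp [hjk]) e
    have n3 := ne (j, 1) (k, 0) (by simp) ((h j).symm.trans e)
    omega
  have inj2 : ∀ j, Function.Injective fun i => (σ (j, i)).2 := fun j i k e => by
    have : σ (j, i) = σ (j, k) := Prod.ext ((h' j i).trans (h' j k).symm) e
    exact congrArg Prod.snd (σ.injective this)
  refine ⟨(Equiv.ofBijective _ (Finite.injective_iff_bijective.1 inj1),
    fun j => Equiv.ofBijective _ (Finite.injective_iff_bijective.1 (inj2 j))), ?_⟩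
  ext1 ⟨j, i⟩
  rw [pairPerm_apply]
  exact Prod.ext (h' j i).symm rfl

/-- A perfect matching of `0, …, 2 N - 1` by adjacent elements is `{0, 1}, {2, 3}, …`. -/
theorem div_two_eq_of_adjacent {N : ℕ} (σ : Equiv.Perm (Fin (N * 2)))
    (h : ∀ j : Fin N, (σ (finProdFinEquiv (j, 1)) : ℕ) = σ (finProdFinEquiv (j, 0)) + 1
      ∨ (σ (finProdFinEquiv (j, 0)) : ℕ) = σ (finProdFinEquiv (j, 1)) + 1) (j : Fin N) :
    (σ (finProdFinEquiv (j, 0)) : ℕ) / 2 = (σ (finProdFinEquiv (j, 1)) : ℕ) / 2 := by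
  have inj : ∀ j k : Fin N, ∀ i l : Fin 2,
      (σ (finProdFinEquiv (j, i)) : ℕ) = σ (finProdFinEquiv (k, l)) → j = k ∧ i = l := by
    intro j k i l e
    simpa using finProdFinEquiv.injective (σ.injective (Fin.ext e))
  have surj : ∀ n < N * 2, ∃ j : Fin N, (σ (finProdFinEquiv (j, 0)) : ℕ) = n
      ∨ (σ (finProdFinEquiv (j, 1)) : ℕ) = n := by
    intro n hn
    obtain ⟨⟨j, i⟩, hx⟩ := (finProdFinEquiv.trans σ).surjective ⟨n, hn⟩
    have hx' : (σ (finProdFinEquiv (j, i)) : ℕ) = n := congrArg Fin.val hx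
    fin_cases i
    · exact ⟨j, .inl hx'⟩
    · exact ⟨j, .inr hx'⟩
  -- No pair joins `2m+1` to `2m+2`, by induction: `0` can only be matched with `1`, and once `2m+2`
  -- cannot be matched with `2m+1` it must take `2m+3`, which is then unavailable to `2m+4`.
  have key : ∀ m : ℕ, ∀ j : Fin N, ∀ i l : Fin 2,
      ¬((σ (finProdFinEquiv (j, i)) : ℕ) = 2 * m + 1
        ∧ (σ (finProdFinEquiv (j, l)) : ℕ) = 2 * m + 2) := by
    intro m
    induction m with
    | zero =>
      rintro j i l ⟨h1, h2⟩
      obtain ⟨k, hk⟩ := surj 0 (by have := (σ (finProdFinEquiv (j, l))).isLt; omega)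
      have : k = j := by
        rcases hk with hk | hk <;> rcases h k with h' | h'
        · exact (inj k j 1 i (by omega)).1
        · omega
        · omega
        · exact (inj k j 0 i (by omega)).1
      subst this
      fin_cases i <;> fin_cases l <;> simp only [Fin.zero_eta, Fin.mk_one] at h1 h2 <;> omega
    | succ m ih =>
      rintro j i l ⟨h1, h2⟩
      obtain ⟨k, hk⟩ := surj (2 * m + 2) (by have := (σ (finProdFinEquiv (j, l))).isLt; omega)
      have : k = j := by
        rcases hk with hk | hk <;> rcases h k with h' | h'
        · exact (inj k j 1 i (by omega)).1
        · exact absurd ⟨by omega, hk⟩ (ih k 1 0)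
        · exact absurd ⟨by omega, hk⟩ (ih k 0 1)
        · exact (inj k j 0 i (by omega)).1
      subst this
      fin_cases i <;> fin_cases l <;> simp only [Fin.zero_eta, Fin.mk_one] at h1 h2 <;> omega
  have k1 := key ((σ (finProdFinEquiv (j, 0)) : ℕ) / 2) j 0 1
  have k2 := key ((σ (finProdFinEquiv (j, 1)) : ℕ) / 2) j 1 0
  have := h j
  omega

/-- A nonzero term forces every pair onto neighbours, hence `σ` comes from a `pairPerm`. The sign of
each inner swap cancels the sign change of `H`, so all `N! 2^N` such terms are equal. -/
theorem sum_perm_tridiagonal (N : ℕ) (H : ℕ → ℕ → ℂ) (g : ℕ → ℂ)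
    (hH : ∀ m n, H m n = if n = m + 1 then g m else if m = n + 1 then -g n else 0) :
    ∑ σ : Equiv.Perm (Fin (N * 2)), ((Equiv.Perm.sign σ : ℤ) : ℂ) * ∏ j : Fin N,
        H (σ (finProdFinEquiv (j, 0))) (σ (finProdFinEquiv (j, 1)))
      = N.factorial * 2 ^ N * ∏ k ∈ Finset.range N, g (2 * k) := by
  let e : Equiv.Perm (Fin N) × (Fin N → Equiv.Perm (Fin 2)) → Equiv.Perm (Fin (N * 2)) :=
    fun x => finProdFinEquiv.permCongr (pairPerm x)
  have he : Function.Injective e := fun x y h => pairPerm_injective (Equiv.injective _ h)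
  have hval : ∀ x j i, e x (finProdFinEquiv (j, i)) = finProdFinEquiv (x.1 j, x.2 j i) :=
    fun x j i => by simp [e, Equiv.permCongr_apply, pairPerm_apply]
  rw [← Fintype.sum_of_injective e he
    (fun _ => ∏ k ∈ Finset.range N, g (2 * k)) _ (fun σ hσ => ?_) (fun x => ?_)]
  · simp [Fintype.card_perm]
  · by_contra hne
    apply hσ
    have hj := fun j => Finset.prod_ne_zero_iff.1 (right_ne_zero_of_mul hne) j (Finset.mem_univ j)
    have hadj := div_two_eq_of_adjacent σ fun j => by
      have := hj j
      rw [hH] at this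
      split_ifs at this with h1 h2
      · exact .inl h1
      · exact .inr h2
      · exact absurd rfl this
    obtain ⟨x, hx⟩ := mem_range_pairPerm (finProdFinEquiv.permCongr.symm σ) fun j => by
      rw [Fin.ext_iff]
      simpa [Equiv.permCongr_symm, Equiv.permCongr_apply] using hadj j
    exact ⟨x, by simp only [e, hx, Equiv.apply_symm_apply]⟩
  · have hs : Equiv.Perm.sign (e x) = ∏ j, Equiv.Perm.sign (x.2 j) := by
      rw [← sign_pairPerm, Equiv.Perm.sign_permCongr]
    rw [hs]
    push_cast
    rw [← Finset.prod_mul_distrib, ← Fin.prod_univ_eq_prod_range (fun k => g (2 * k)),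
      ← Equiv.prod_comp x.1]
    refine Finset.prod_congr rfl fun j _ => ?_
    rw [hval, hval, hH]
    generalize x.2 j = τ
    have hτ : τ = 1 ∨ τ = Equiv.swap 0 1 := by
      revert τ
      decide
    rcases hτ with rfl | rfl
    · simp [finProdFinEquiv_apply_val, add_comm]
    · simp [finProdFinEquiv_apply_val, add_comm]
      omega

/-! ### The partition function of a planar symplectic ensemble with quadratic potential -/

section

variable {W : ℂ → ℝ} {a b : ℝ}

theorem integral_skew_gaussianPairingIntegrand (ha : 0 < a) (hb : 0 < b) (f g : ℂ[X]) :
    Integrable (fun z => (z - conj z) * (planarGaussian a b z : ℂ)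
      * (f.eval z * g.eval (conj z))) ∧
    ∫ z, (z - conj z) * (planarGaussian a b z : ℂ) * (f.eval z * g.eval (conj z))
      = gaussianSkewPairing a b f g := by
  have hi := integrable_gaussianPairingIntegrand ha hb
  have e : (fun z => (z - conj z) * (planarGaussian a b z : ℂ) * (f.eval z * g.eval (conj z)))
      = fun z => gaussianPairingIntegrand a b (Polynomial.X * f) g z
        - gaussianPairingIntegrand a b f (Polynomial.X * g) z := by
    ext z
    simp only [gaussianPairingIntegrand, Polynomial.eval_mul, Polynomial.eval_X]
    ring
  rw [e]
  exact ⟨(hi _ _).sub (hi _ _), integral_sub (hi _ _) (hi _ _)⟩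

theorem symplecticPartition_quadratic (ha : 0 < a) (hb : 0 < b)
    (hW : ∀ z, W z = a * z.re ^ 2 + b * z.im ^ 2) (N : ℕ) :
    Integrable (symplecticWeight W N) ∧
      symplecticPartition W N = ∏ k ∈ Finset.range N, (2 * gaussianSkewNorm a b (2 * k)) := by
  set q := monicHermite (1 / (4 * a) - 1 / (4 * b)) with hq
  have hexp : ∀ z, Real.exp (-2 * W z) = planarGaussian a b z := fun z => by
    rw [hW, planarGaussian]
  have hw := ofReal_symplecticWeight_eq_sum W N q (monicHermite_monic_natDegree _)
  simp only [hexp] at hw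
  have hone := fun m n => integral_skew_gaussianPairingIntegrand ha hb (q m) (q n)
  have hint : ∀ σ : Equiv.Perm (Fin (N * 2)), Integrable fun z : Fin N → ℂ =>
      ((Equiv.Perm.sign σ : ℤ) : ℂ) * ∏ j : Fin N,
        ((z j - conj (z j)) * (planarGaussian a b (z j) : ℂ)
          * ((q (σ (finProdFinEquiv (j, 0)))).eval (z j)
            * (q (σ (finProdFinEquiv (j, 1)))).eval (conj (z j)))) := fun σ =>
    (Integrable.fintype_prod (μ := fun _ => volume) fun j => (hone _ _).1).const_mul _
  have hI : Integrable fun z => (symplecticWeight W N z : ℂ) := by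
    simp only [hw]
    exact integrable_finsetSum _ fun σ _ => hint σ
  have hZ : ∫ z, (symplecticWeight W N z : ℂ)
      = N.factorial * 2 ^ N * ∏ k ∈ Finset.range N, (gaussianSkewNorm a b (2 * k) : ℂ) := by
    simp only [hw]
    rw [integral_finsetSum _ fun σ _ => hint σ]
    refine Eq.trans (Finset.sum_congr rfl fun σ _ => ?_)
      (sum_perm_tridiagonal N (fun m n => gaussianSkewPairing a b (q m) (q n))
        (fun n => (gaussianSkewNorm a b n : ℂ)) (gaussianSkewPairing_monicHermite ha hb))
    rw [integral_const_mul]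
    congr 1
    refine (integral_fintype_prod_volume_eq_prod (fun (j : Fin N) (z : ℂ) =>
      (z - conj z) * (planarGaussian a b z : ℂ)
          * ((q (σ (finProdFinEquiv (j, 0)))).eval z
            * (q (σ (finProdFinEquiv (j, 1)))).eval (conj z)))).trans ?_
    exact Finset.prod_congr rfl fun j _ => (hone _ _).2
  refine ⟨by simpa using hI.re, ?_⟩
  rw [integral_complex_ofReal] at hZ
  have hZ' : ∫ z, symplecticWeight W N z
      = N.factorial * 2 ^ N * ∏ k ∈ Finset.range N, gaussianSkewNorm a b (2 * k) := by
    exact_mod_cast hZ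
  have hf : (N.factorial : ℝ) ≠ 0 := by positivity
  rw [symplecticPartition, hZ', Finset.prod_mul_distrib, Finset.prod_const, Finset.card_range]
  field_simp

theorem gaussianSkewNorm_pos (ha : 0 < a) (hb : 0 < b) (n : ℕ) : 0 < gaussianSkewNorm a b n := by
  have := Real.pi_pos
  unfold gaussianSkewNorm
  positivity

theorem log_two_mul_gaussianSkewNorm (ha : 0 < a) (hb : 0 < b) (k : ℕ) :
    Real.log (2 * gaussianSkewNorm a b (2 * k)) = Real.log (2 * k + 1).factorial
      + 2 * k * Real.log (1 / (4 * a) + 1 / (4 * b))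
      + (Real.log Real.pi - Real.log 2 - 3 / 2 * Real.log b - Real.log a / 2) := by
  have hpi := Real.pi_pos
  have e : 2 * gaussianSkewNorm a b (2 * k) = (2 * k + 1).factorial
      * (1 / (4 * a) + 1 / (4 * b)) ^ (2 * k) * (Real.pi / (2 * b * √(a * b))) := by
    unfold gaussianSkewNorm
    field_simp
  rw [e, Real.log_mul (by positivity) (by positivity), Real.log_mul (by positivity) (by positivity),
    Real.log_pow, Real.log_div (by positivity) (by positivity), Real.log_mul (by positivity)
    (by positivity), Real.log_mul (by positivity) (by positivity), Real.log_sqrt (by positivity),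
    Real.log_mul (by positivity) (by positivity)]
  push_cast
  ring

theorem log_symplecticPartition_quadratic (ha : 0 < a) (hb : 0 < b)
    (hW : ∀ z, W z = a * z.re ^ 2 + b * z.im ^ 2) (N : ℕ) :
    Real.log (symplecticPartition W N)
      = ∑ k ∈ Finset.range N, Real.log (2 * k + 1).factorial
        + N * (N - 1) * Real.log (1 / (4 * a) + 1 / (4 * b))
        + N * (Real.log Real.pi - Real.log 2 - 3 / 2 * Real.log b - Real.log a / 2) := by
  have hs : ∑ k ∈ Finset.range N, 2 * (k : ℝ) = N * (N - 1) := by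
    induction N with
    | zero => simp
    | succ n ih =>
      rw [Finset.sum_range_succ, ih]
      push_cast
      ring
  rw [(symplecticPartition_quadratic ha hb hW N).2, Real.log_prod fun k _ =>
    (mul_pos two_pos (gaussianSkewNorm_pos ha hb _)).ne']
  simp only [log_two_mul_gaussianSkewNorm ha hb]
  rw [Finset.sum_add_distrib, Finset.sum_add_distrib, ← Finset.sum_mul, hs, Finset.sum_const,
    Finset.card_range, nsmul_eq_mul]

theorem symplecticPartition_quadratic_pos (ha : 0 < a) (hb : 0 < b)
    (hW : ∀ z, W z = a * z.re ^ 2 + b * z.im ^ 2) (N : ℕ) : 0 < symplecticPartition W N := by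
  rw [(symplecticPartition_quadratic ha hb hW N).2]
  exact Finset.prod_pos fun k _ => mul_pos two_pos (gaussianSkewNorm_pos ha hb _)

end

/-! ### The elliptic and Ginibre potentials. -/

theorem ellipticPotential_eq {τ : ℝ} (h0 : 0 ≤ τ) (h1 : τ < 1) (z : ℂ) :
    ellipticPotential τ z = 1 / (1 + τ) * z.re ^ 2 + 1 / (1 - τ) * z.im ^ 2 := by
  have h2 : 1 - τ ≠ 0 := by linarith
  have h3 : 1 + τ ≠ 0 := by linarith
  have h4 : 1 - τ ^ 2 ≠ 0 := by
    rw [show 1 - τ ^ 2 = (1 - τ) * (1 + τ) by ring]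
    exact mul_ne_zero h2 h3
  rw [ellipticPotential, Complex.sq_norm, Complex.normSq_apply, sq z, Complex.mul_re]
  field_simp
  ring

theorem mainTheorem9 :
    (∃ C : ℝ, ∀ τ : ℝ, 0 ≤ τ → τ < 1 → ∀ N : ℕ, 1 ≤ N →
      Integrable (symplecticWeight (ellipticPotential τ) N) ∧
      0 < symplecticPartition (ellipticPotential τ) N ∧
      |Real.log (symplecticPartition (ellipticPotential τ) N) -
        ((N : ℝ) ^ 2 * Real.log N - 3 / 2 * (N : ℝ) ^ 2 + 1 / 2 * N * Real.log N
          + (Real.log (4 * Real.pi ^ 3 * (1 - τ) ^ 3 * (1 + τ)) / 2 - 1 / 2) * N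
          - 1 / 24 * Real.log N + 5 * Real.log 2 / 24 + 1 / 2 * (deriv riemannZeta (-1)).re
          - 1 / (48 * (N : ℝ)) - 1 / (1920 * (N : ℝ) ^ 2))| ≤ C / (N : ℝ) ^ 3) ∧
    (∃ C : ℝ, ∀ N : ℕ, 1 ≤ N →
      Integrable (symplecticWeight (fun z => N * ginSEPotential z) N) ∧
      0 < symplecticPartition (fun z => N * ginSEPotential z) N ∧
      |Real.log (symplecticPartition (fun z => N * ginSEPotential z) N) -
        (- (3 / 2) * (N : ℝ) ^ 2 - 1 / 2 * N * Real.log N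
          + (Real.log (4 * Real.pi ^ 3) / 2 - 1 / 2) * N
          - 1 / 24 * Real.log N + 5 * Real.log 2 / 24 + 1 / 2 * (deriv riemannZeta (-1)).re
          - 1 / (48 * (N : ℝ)) - 1 / (1920 * (N : ℝ) ^ 2))| ≤ C / (N : ℝ) ^ 3) := by
  refine ⟨⟨1, fun τ h0 h1 N hN => ?_⟩, ⟨1, fun N hN => ?_⟩⟩
  · have p1 : 0 < 1 - τ := by linarith
    have p2 : 0 < 1 + τ := by linarith
    have ha : 0 < 1 / (1 + τ) := by positivity
    have hb : 0 < 1 / (1 - τ) := by positivity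
    have hW := ellipticPotential_eq h0 h1
    refine ⟨(symplecticPartition_quadratic ha hb hW N).1,
      symplecticPartition_quadratic_pos ha hb hW N, ?_⟩
    have hpi := Real.pi_pos
    -- The growth parameter of the skew norms does not depend on `τ`, so `τ` enters only through an
    -- exact term linear in `N`. The error is therefore that of `∑ log (2k+1)!`, which makes the
    -- constant absolute.
    have hq : 1 / (4 * (1 / (1 + τ))) + 1 / (4 * (1 / (1 - τ))) = (2 : ℝ)⁻¹ := by
      field_simp
      ring
    have h4 : Real.log 4 = 2 * Real.log 2 := by
      rw [show (4 : ℝ) = 2 ^ 2 by norm_num, Real.log_pow]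
      norm_num
    have hlog : Real.log (4 * Real.pi ^ 3 * (1 - τ) ^ 3 * (1 + τ))
        = 2 * Real.log 2 + 3 * Real.log Real.pi + 3 * Real.log (1 - τ) + Real.log (1 + τ) := by
      rw [Real.log_mul (by positivity) (by positivity), Real.log_mul (by positivity) (by positivity),
        Real.log_mul (by positivity) (by positivity), Real.log_pow, Real.log_pow, h4]
      norm_num
    rw [log_symplecticPartition_quadratic ha hb hW, hq, hlog, Real.log_inv, one_div (1 - τ),
      one_div (1 + τ), Real.log_inv, Real.log_inv]
    convert! abs_sum_log_factorial_odd_sub_le N hN using 2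
    ring
  · have hx : (0 : ℝ) < N := by exact_mod_cast hN
    have hW : ∀ z, (fun z => N * ginSEPotential z) z = (N : ℝ) * z.re ^ 2 + N * z.im ^ 2 :=
      fun z => by
        simp only [ginSEPotential]
        rw [Complex.sq_norm, Complex.normSq_apply]
        ring
    refine ⟨(symplecticPartition_quadratic hx hx hW N).1,
      symplecticPartition_quadratic_pos hx hx hW N, ?_⟩
    have hpi := Real.pi_pos
    -- With `a = b = N` the extra powers of `N` contribute `-(N² + N) log N`, which removes the `N²
    -- log N` term and flips the sign of `(1/2) N log N`.
    have hq : 1 / (4 * (N : ℝ)) + 1 / (4 * N) = (2 * (N : ℝ))⁻¹ := by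
      field_simp
      norm_num
    have h4 : Real.log 4 = 2 * Real.log 2 := by
      rw [show (4 : ℝ) = 2 ^ 2 by norm_num, Real.log_pow]
      norm_num
    have hlog : Real.log (4 * Real.pi ^ 3) = 2 * Real.log 2 + 3 * Real.log Real.pi := by
      rw [Real.log_mul (by positivity) (by positivity), Real.log_pow, h4]
      norm_num
    rw [log_symplecticPartition_quadratic hx hx hW, hq, hlog, Real.log_inv,
      Real.log_mul two_ne_zero hx.ne']
    convert! abs_sum_log_factorial_odd_sub_le N hN using 2
    ring
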